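/- **Setting.** Let $T$ be a locally finite tree (finite or infinite, possibly with leaves) with a root vertex $o$ that is the endpoint of exactly one edge, the root edge $\omega$. Let $E(T)$ be its edge set. For an edge $\alpha$, let $b(\alpha)$ and $e(\alpha)$ be its endpoints, $b(\alpha)$ being the one closer to $o$. Write $\beta\ge\alpha$ if the geodesic from $o$ to $e(\beta)$ passes through $\alpha$. An edge $\alpha$ is a leaf if no $\beta\neq\alpha$ satisfies $\beta\ge\alpha$. The boundary $\partial T$ is the set of half-infinite geodesics starting at $o$ together with the leaves. For $\zeta\in\partial T$, let $P(\zeta)\subseteq E(T)$ be the set of edges of the geodesic from $o$ to $\zeta$, and let $\partial T_\alpha=\{\zeta\in\partial T:\alpha\in P(\zeta)\}$; these sets are a basis of the topology of $\partial T$. For $f:E(T)\to[0,\infty)$ put $If(\zeta)=\sum_{\alpha\in P(\zeta)}f(\alpha)\in[0,\infty]$. The capacity of an arbitrary set $E\subseteq\partial T$ is $$c_2(E)=\inf\Big\{\sum_{\alpha\in E(T)}f(\alpha)^2:\ f\ge0,\ If\ge1\text{ on }E\Big\}.$$ An equilibrium measure of $E$ is a positive Borel measure $\mu$ on $\partial T$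 whose co-potential $M(\alpha)=\mu(\partial T_\alpha)$ satisfies $IM\ge1$ on $E$ outside a set of zero capacity, and $\sum_{\alpha}M(\alpha)^2=c_2(E)=\mu(\partial T)$. Squares and rectangles in the plane are closed with sides parallel to the axes; squares of side $0$ (points) are allowed. A countable family of squares $\{Q_j\}$ is a *square tiling* of a rectangle $R$ if the interiors of the $Q_j$ are pairwise disjoint, $R=\overline{\bigcup_jQ_j}$, and $R\setminus\bigcup_jQ_j$ has area zero. The combinatorics of a family $\{Q_\alpha\}_{\alpha\in E(T)}$ is *prescribed by* $T$ if the upper side of $Q_\alpha$ is contained in the lower side of $Q_\beta$ whenever $b(\alpha)=e(\beta)$. **Theorem.** (i) Every set $E\subseteq\partial T$ has a unique equilibrium measure $\mu^E$. If $c_2(E)>0$, then there is a square tiling $\{Q_\alpha\}_{\alpha\in E(T)}$ of the rectangle $[0,c_2(E)]\times[0,1]$ whose combinatorics is prescribed by $T$ and such that $Q_\alpha$ has side length $\mu^E(\partial T_\alpha)$ for every $\alpha\in E(T)$. (ii) Conversely, let $c>0$ and let $\{Q_\alpha\}_{\alpha\in E(T)}$ be a square tiling of $[0,c]\times[0,1]$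 with combinatorics prescribed by $T$. Suppose that, for every edge $\beta$ which is not a leaf and for which $Q_\beta$ has positive side, at least one edge $\alpha$ with $b(\alpha)=e(\beta)$ has $Q_\alpha$ of positive side (this holds in particular if no $Q_\alpha$ is degenerate). Then there exist an $F_\sigma$ set $E\subseteq\partial T$ and a Borel measure $\mu$ on $\partial T$ such that $\mu(\partial T_\alpha)$ is the side length of $Q_\alpha$ for every $\alpha\in E(T)$, and $\mu$ is the equilibrium measure of $E$. -/

import Mathlib

open MeasureTheory
open scoped ENNReal

noncomputable section

/-- A locally finite tree with a distinguished root vertex `o = root` which is the endpoint of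
exactly one edge, the root edge `ω`. Finite trees and trees with leaves are allowed. -/
structure PlantedTree (V : Type*) where
  graph : SimpleGraph V
  isTree : graph.IsTree
  locallyFinite : ∀ v, (graph.neighborSet v).Finite
  root : V
  existsUnique_adj_root : ∃! v, graph.Adj root v

namespace PlantedTree

variable {V : Type*}

/-- An edge `α` of the tree, written with its beginning vertex `b(α)` and its ending vertex `e(α)`:
`b(α)` is the endpoint closer to the root. Every edge of the graph has exactly one such
orientation, so this type is in bijection with the set of edges of the graph. -/
structure Edge (T : PlantedTree V) where
  b : V
  e : V
  adj : T.graph.Adj b e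
  dist_lt : T.graph.dist T.root b < T.graph.dist T.root e

variable (T : PlantedTree V)

/-- The predecessor set `P(x)` of a vertex `x`: the edges of the geodesic from the root to `x`. -/
def vertexPred (x : V) : Set T.Edge :=
  {α | ∃ p : T.graph.Walk T.root x, p.IsPath ∧ s(α.b, α.e) ∈ p.edges}

variable {T} in
/-- `α ≤ β`: the geodesic which departs from the root and ends with `β` passes through `α`. -/
def Edge.Precedes (α β : T.Edge) : Prop :=
  α ∈ T.vertexPred β.e

variable {T} in
/-- An edge is a leaf if no other edge lies beyond it. -/
def Edge.IsLeaf (α : T.Edge) : Prop :=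
  ∀ β : T.Edge, α.Precedes β → β = α

/-- The boundary `∂T`: the half-infinite geodesics starting from the root, together with
the leaves. -/
inductive Boundary : Type _
  | ray (r : ℕ → V) (zero : r 0 = T.root) (adj : ∀ n, T.graph.Adj (r n) (r (n + 1)))
      (inj : Function.Injective r) : Boundary
  | leaf (α : T.Edge) (isLeaf : α.IsLeaf) : Boundary

/-- The predecessor set `P(ζ)` of a boundary point `ζ`: the edges of the geodesic from the root
to `ζ`. -/
def pred : T.Boundary → Set T.Edge
  | .ray r _ _ _ => {α | ∃ n, α.b = r n ∧ α.e = r (n + 1)}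
  | .leaf α _ => {β | β.Precedes α}

/-- The boundary `∂T_α` of the tent rooted in `α`, as a subset of `∂T`. -/
def tentBoundary (α : T.Edge) : Set T.Boundary :=
  {ζ | α ∈ T.pred ζ}

/-- The topology on `∂T` generated by the sets `∂T_α`. -/
instance : TopologicalSpace T.Boundary :=
  TopologicalSpace.generateFrom (Set.range T.tentBoundary)

instance : MeasurableSpace T.Boundary := borel T.Boundary

instance : BorelSpace T.Boundary := ⟨rfl⟩

/-- The potential `I f (ζ)`, the sum of `f` over the edges of the geodesic from the root to `ζ`,
with values in `[0, ∞]`. -/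
def potential (f : T.Edge → ℝ≥0∞) (ζ : T.Boundary) : ℝ≥0∞ :=
  ∑' α : T.pred ζ, f α

/-- The co-potential `I^* μ (α) = μ(∂T_α)` of a measure on the boundary. -/
def copotential (μ : Measure T.Boundary) (α : T.Edge) : ℝ≥0∞ :=
  μ (T.tentBoundary α)

/-- The capacity `c_2(E)`, the infimum of `‖f‖_2^2` over the nonnegative edge functions `f` such
that `I f ≥ 1` on `E`. Functions of infinite norm do not affect the infimum, because the
indicator function of the root edge is admissible for every `E`. -/
def capacity (E : Set T.Boundary) : ℝ≥0∞ :=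
  ⨅ (f : T.Edge → ℝ≥0∞) (_ : ∀ ζ ∈ E, 1 ≤ T.potential f ζ), ∑' α, f α ^ 2

/-- `μ` is the (`2`-)equilibrium measure of `E`: its co-potential `M = I^* μ` satisfies `I M ≥ 1`
on `E` outside a set of zero capacity, and `‖M‖_2^2 = c_2(E) = μ(∂T)`. -/
structure IsEquilibriumMeasure (E : Set T.Boundary) (μ : Measure T.Boundary) : Prop where
  capacity_exceptional : T.capacity {ζ ∈ E | T.potential (T.copotential μ) ζ < 1} = 0
  energy_eq : ∑' α, T.copotential μ α ^ 2 = T.capacity E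
  mass_eq : μ Set.univ = T.capacity E

end PlantedTree

/-- An axis-parallel closed square in the plane, given by its lower left corner `(x, y)` and its
side length. Side length `0` (a square degenerated to a point) is allowed. -/
structure PlaneSquare where
  x : ℝ
  y : ℝ
  side : ℝ
  side_nonneg : 0 ≤ side

namespace PlaneSquare

/-- The square as a set of points. -/
def carrier (Q : PlaneSquare) : Set (ℝ × ℝ) :=
  Set.Icc Q.x (Q.x + Q.side) ×ˢ Set.Icc Q.y (Q.y + Q.side)

/-- The upper side of the square. -/
def upperSide (Q : PlaneSquare) : Set (ℝ × ℝ) :=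
  Set.Icc Q.x (Q.x + Q.side) ×ˢ {Q.y + Q.side}

/-- The lower side of the square. -/
def lowerSide (Q : PlaneSquare) : Set (ℝ × ℝ) :=
  Set.Icc Q.x (Q.x + Q.side) ×ˢ {Q.y}

end PlaneSquare

/-- A family of squares is a square tiling of `R`: the interiors are pairwise disjoint, `R` is the
closure of the union, and the squares exhaust the area of `R`. For a finite family the last
condition follows from the second one. -/
structure IsSquareTiling {ι : Type*} (Q : ι → PlaneSquare) (R : Set (ℝ × ℝ)) : Prop where
  disjoint_interior : ∀ i j, i ≠ j → Disjoint (interior (Q i).carrier) (interior (Q j).carrier)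
  closure_eq : closure (⋃ i, (Q i).carrier) = R
  volume_diff : volume (R \ ⋃ i, (Q i).carrier) = 0

/-- The combinatorics of a family of squares indexed by the edges of `T` is prescribed by `T`:
the upper side of `Q_α` lies in the lower side of `Q_β` whenever `b(α) = e(β)`. -/
def PlantedTree.PrescribesCombinatorics {V : Type*} (T : PlantedTree V)
    (Q : T.Edge → PlaneSquare) : Prop :=
  ∀ α β : T.Edge, α.b = β.e → (Q α).upperSide ⊆ (Q β).lowerSide

/-- Whenever `β` is not a leaf and `Q_β` is not degenerate, at least one of the squares directly
below `Q_β` is not degenerate. This holds in particular if no square is degenerate. -/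
def PlantedTree.DegeneratesOnlyProperly {V : Type*} (T : PlantedTree V)
    (Q : T.Edge → PlaneSquare) : Prop :=
  ∀ β : T.Edge, ¬ β.IsLeaf → 0 < (Q β).side → ∃ α : T.Edge, α.b = β.e ∧ 0 < (Q α).side

end

/-!
A tiling with the combinatorics of `T` is the same thing as a nonnegative function `m` on the edges
(the side lengths) which is a flow (`m α` is the sum of `m` over the edges directly beyond `α`),
whose sums along the geodesics from the root are at most `1`, and whose energy `∑ m α ^ 2` is equal
to its mass `m ω`. Indeed the squares with these sides can be hung below each other in only one way
up to the order of siblings, and the last condition says that they exhaust the area.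

The equilibrium function of `E` is the element of minimal norm of the closed convex set of all
`f ≥ 0` in `ℓ²` with `I f ≥ 1` quasi-everywhere on `E`. Shifting its values from an edge to the
edges beyond it, or back, yields another element of this set as long as no potential decreases on
`E`, so minimality forces the three properties above. A flow is the co-potential of a measure on
`∂T`, since the half-open intervals below the squares of a generation subdivide `[0, m ω)`: the
measure is the law of the boundary point which lies below a random point of this interval.

Conversely, in a tiling the area below a square which its children do not cover stays uncovered,
which forces `m` to be a flow. As `∫ I m ∂μ` is the energy of `m`, which is equal to its mass, and
`I m ≤ 1`, the potential is `1` almost everywhere; a full `F_σ` subset of `{I m = 1}` is the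
required set.
-/

namespace PlantedTree

variable {V : Type*} {T : PlantedTree V}

theorem length_eq_dist {x y : V} {p : T.graph.Walk x y} (hp : p.IsPath) :
    p.length = T.graph.dist x y := by
  obtain ⟨q, hq, hl⟩ := T.isTree.connected.exists_path_of_dist x y
  rw [(T.isTree.existsUnique_path x y).unique hp hq, hl]

theorem mem_vertexPred_iff {x : V} {p : T.graph.Walk T.root x} (hp : p.IsPath) (β : T.Edge) :
    β ∈ T.vertexPred x ↔ s(β.b, β.e) ∈ p.edges := by
  refine ⟨?_, fun h => ⟨p, hp, h⟩⟩
  rintro ⟨q, hq, h⟩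
  rwa [(T.isTree.existsUnique_path _ _).unique hp hq]

namespace Edge

/-- The number of edges strictly before an edge on the geodesic from the root. -/
noncomputable def depth (α : T.Edge) : ℕ := T.graph.dist T.root α.b

theorem dist_e (α : T.Edge) : T.graph.dist T.root α.e = α.depth + 1 :=
  (T.isTree.dist_eq_dist_add_one_of_adj T.root α.adj).resolve_left (by have := α.dist_lt; omega)

theorem depth_child {α β : T.Edge} (h : β.b = α.e) : β.depth = α.depth + 1 := by
  rw [depth, h, dist_e]

theorem depth_eq_zero {α : T.Edge} : α.depth = 0 ↔ α.b = T.root := by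
  rw [depth, T.isTree.connected.dist_eq_zero_iff, eq_comm]

theorem e_ne_root (α : T.Edge) : α.e ≠ T.root := by
  intro h
  have := α.dist_e
  rw [h, SimpleGraph.dist_self] at this
  omega

theorem isPath_concat (α : T.Edge) {q : T.graph.Walk T.root α.b} (hq : q.IsPath) :
    (q.concat α.adj).IsPath := by
  classical
  refine hq.concat (fun h => ?_) α.adj
  have h1 := SimpleGraph.dist_le (q.takeUntil _ h)
  have h2 := q.length_takeUntil_le_length h
  have h3 := T.length_eq_dist hq
  have h4 := α.dist_lt
  omega

theorem eq_of_e_eq {α β : T.Edge} (h : α.e = β.e) : α = β := by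
  obtain ⟨p, hp⟩ := T.isTree.connected.preconnected.exists_isPath T.root α.b
  obtain ⟨q, hq⟩ := T.isTree.connected.preconnected.exists_isPath T.root β.b
  have hp' := α.isPath_concat hp
  have hq' := β.isPath_concat hq
  cases α
  cases β
  subst h
  have hb := congrArg SimpleGraph.Walk.penultimate
    ((T.isTree.existsUnique_path _ _).unique hp' hq')
  simp only [SimpleGraph.Walk.penultimate_concat] at hb
  subst hb
  rfl

theorem exists_e_eq {v : V} (hv : v ≠ T.root) : ∃ α : T.Edge, α.e = v := by
  obtain ⟨p, -, hl⟩ := T.isTree.connected.exists_path_of_dist T.root v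
  have hn : ¬ p.Nil := SimpleGraph.Walk.not_nil_of_ne hv.symm
  refine ⟨⟨p.penultimate, v, SimpleGraph.Walk.adj_penultimate hn, ?_⟩, rfl⟩
  have h1 := SimpleGraph.dist_le p.dropLast
  have h2 := SimpleGraph.Walk.length_dropLast_add_one hn
  omega

theorem exists_b_eq_root (T : PlantedTree V) : ∃ α : T.Edge, α.b = T.root := by
  obtain ⟨v, hv, -⟩ := T.existsUnique_adj_root
  refine ⟨⟨T.root, v, hv, ?_⟩, rfl⟩
  rw [SimpleGraph.dist_self]
  exact T.isTree.connected.pos_dist_of_ne hv.ne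

/-- The bottom edge `⊥` is the root edge `ω`. -/
noncomputable instance : Bot T.Edge := ⟨(exists_b_eq_root T).choose⟩

theorem b_eq_root_iff {α : T.Edge} : α.b = T.root ↔ α = ⊥ := by
  have hbot : (⊥ : T.Edge).b = T.root := (exists_b_eq_root T).choose_spec
  refine ⟨fun h => eq_of_e_eq ?_, fun h => h ▸ hbot⟩
  exact T.existsUnique_adj_root.unique (h ▸ α.adj) (hbot ▸ (⊥ : T.Edge).adj)

theorem eq_bot_or_exists_parent (α : T.Edge) : α = ⊥ ∨ ∃ β : T.Edge, α.b = β.e := by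
  rw [← b_eq_root_iff, or_iff_not_imp_left]
  exact fun h => (exists_e_eq h).imp fun _ h => h.symm

theorem induction_children {P : T.Edge → Prop} (bot : P ⊥)
    (child : ∀ α β : T.Edge, β.b = α.e → P α → P β) (α : T.Edge) : P α := by
  induction hn : α.depth generalizing α with
  | zero => exact b_eq_root_iff.1 (depth_eq_zero.1 hn) ▸ bot
  | succ n ih =>
    obtain rfl | ⟨β, hβ⟩ := α.eq_bot_or_exists_parent
    · exact bot
    · exact child β α hβ (ih β (by have := depth_child hβ; omega))

/-- The order of the edges along the geodesics which depart from the root. -/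
instance : LE T.Edge := ⟨Precedes⟩

theorem le_iff_eq_or_mem {α β : T.Edge} : β ≤ α ↔ β = α ∨ β ∈ T.vertexPred α.b := by
  obtain ⟨p, hp⟩ := T.isTree.connected.preconnected.exists_isPath T.root α.b
  change β ∈ T.vertexPred α.e ↔ _
  rw [mem_vertexPred_iff (α.isPath_concat hp), mem_vertexPred_iff hp,
    SimpleGraph.Walk.edges_concat, List.concat_eq_append, List.mem_append, List.mem_singleton,
    or_comm]
  refine or_congr_left ⟨fun h => ?_, fun h => by rw [h]⟩
  obtain h | ⟨hb, he⟩ := Sym2.eq_iff.1 h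
  · exact eq_of_e_eq h.2
  · have h1 := α.dist_lt
    have h2 := β.dist_lt
    rw [hb, he] at h2
    omega

theorem le_child_iff {α β γ : T.Edge} (h : β.b = α.e) : γ ≤ β ↔ γ = β ∨ γ ≤ α := by
  rw [le_iff_eq_or_mem, h]
  rfl

theorem le_bot_iff_eq_bot {α : T.Edge} : α ≤ ⊥ ↔ α = ⊥ := by
  rw [le_iff_eq_or_mem, or_iff_left]
  rw [b_eq_root_iff.2 rfl, mem_vertexPred_iff (SimpleGraph.Walk.IsPath.nil (u := T.root))]
  exact List.not_mem_nil

theorem eq_or_depth_lt {α β : T.Edge} (h : α ≤ β) : α = β ∨ α.depth < β.depth := by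
  induction β using induction_children with
  | bot => exact .inl (le_bot_iff_eq_bot.1 h)
  | child γ β hβ ih =>
    have := depth_child hβ
    obtain h | h := (le_child_iff hβ).1 h
    · exact .inl h
    · obtain rfl | h := ih h <;> exact .inr (by omega)

instance : PartialOrder T.Edge where
  le_refl α := le_iff_eq_or_mem.2 (.inl rfl)
  le_trans α β γ hαβ hβγ := by
    induction γ using induction_children with
    | bot => exact le_bot_iff_eq_bot.1 hβγ ▸ hαβ
    | child δ γ hγ ih =>
      obtain rfl | h := (le_child_iff hγ).1 hβγ
      exacts [hαβ, (le_child_iff hγ).2 (.inr (ih h))]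
  le_antisymm α β hαβ hβα := by
    obtain h | h := eq_or_depth_lt hαβ
    · exact h
    · obtain h' | h' := eq_or_depth_lt hβα
      exacts [h'.symm, absurd h' h.not_gt]

theorem depth_strictMono : StrictMono (depth : T.Edge → ℕ) :=
  fun _ _ h => (eq_or_depth_lt h.le).resolve_left h.ne

theorem lt_child {α β : T.Edge} (h : β.b = α.e) : α < β :=
  lt_of_le_of_ne ((le_child_iff h).2 (.inr le_rfl))
    (by rintro rfl; exact α.adj.ne h)

noncomputable instance : OrderBot T.Edge where
  bot_le α := by
    induction α using induction_children with
    | bot => exact le_rfl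
    | child α β hβ ih => exact ih.trans (lt_child hβ).le

theorem eq_or_exists_child_le {α β : T.Edge} (h : α ≤ β) :
    α = β ∨ ∃ γ : T.Edge, γ.b = α.e ∧ γ ≤ β := by
  induction β using induction_children with
  | bot => exact .inl (le_bot_iff_eq_bot.1 h)
  | child γ β hβ ih =>
    obtain h | h := (le_child_iff hβ).1 h
    · exact .inl h
    · obtain rfl | ⟨δ, hδ, h⟩ := ih h
      exacts [.inr ⟨β, hβ, le_rfl⟩, .inr ⟨δ, hδ, h.trans (lt_child hβ).le⟩]

theorem antitone_of_child {γ : Type*} [Preorder γ] {f : T.Edge → γ}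
    (hf : ∀ α β : T.Edge, β.b = α.e → f β ≤ f α) : Antitone f := by
  intro α β h
  induction β using induction_children with
  | bot => rw [le_bot_iff_eq_bot.1 h]
  | child γ β hβ ih =>
    obtain rfl | h := (le_child_iff hβ).1 h
    exacts [le_rfl, (hf γ β hβ).trans (ih h)]

theorem isLeaf_iff {α : T.Edge} : α.IsLeaf ↔ ∀ β : T.Edge, β.b ≠ α.e := by
  refine ⟨fun h β hβ => (lt_child hβ).ne' (h β (lt_child hβ).le), fun h β hβ => ?_⟩
  obtain h' | ⟨γ, hγ, -⟩ := eq_or_exists_child_le hβ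
  exacts [h'.symm, absurd hγ (h γ)]

theorem comparable_or_exists_siblings (α β : T.Edge) :
    α ≤ β ∨ β ≤ α ∨ ∃ α' β' : T.Edge, α'.b = β'.b ∧ α' ≠ β' ∧ α' ≤ α ∧ β' ≤ β := by
  induction α using induction_children with
  | bot => exact .inl bot_le
  | child γ α hα ih =>
    have hγα := (lt_child hα).le
    obtain h | h | ⟨γ', β', hb, hne, hγ', hβ'⟩ := ih
    · obtain rfl | ⟨β', hβ', h⟩ := eq_or_exists_child_le h
      · exact .inr (.inl hγα)
      · by_cases he : α = β'
        · exact .inl (he ▸ h)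
        · exact .inr (.inr ⟨α, β', hα.trans hβ'.symm, he, le_rfl, h⟩)
    · exact .inr (.inl (h.trans hγα))
    · exact .inr (.inr ⟨γ', β', hb, hne, hγ'.trans hγα, hβ'⟩)

theorem le_total_of_le {α β γ : T.Edge} (hα : α ≤ γ) (hβ : β ≤ γ) : α ≤ β ∨ β ≤ α := by
  induction γ using induction_children with
  | bot => exact .inl (le_bot_iff_eq_bot.1 hα ▸ bot_le)
  | child δ γ hγ ih =>
    obtain rfl | hα' := (le_child_iff hγ).1 hα
    · exact .inr hβ
    · obtain rfl | hβ' := (le_child_iff hγ).1 hβ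
      exacts [.inl hα, ih hα' hβ']

theorem not_le_and_le_of_siblings {α β γ : T.Edge} (hb : α.b = β.b) (hne : α ≠ β) :
    ¬ (α ≤ γ ∧ β ≤ γ) := by
  have hd : α.depth = β.depth := congrArg (T.graph.dist T.root) hb
  rintro ⟨hα, hβ⟩
  obtain h | h := le_total_of_le hα hβ
  · exact (depth_strictMono (lt_of_le_of_ne h hne)).ne hd
  · exact (depth_strictMono (lt_of_le_of_ne h hne.symm)).ne' hd

theorem finite_Iic (α : T.Edge) : (Set.Iic α).Finite := by
  induction α using induction_children with
  | bot => exact (Set.finite_singleton ⊥).subset fun _ h => le_bot_iff_eq_bot.1 h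
  | child α β hβ ih =>
    exact (ih.insert β).subset fun _ h => (le_child_iff hβ).1 h

open Classical in
noncomputable instance : LocallyFiniteOrderBot T.Edge :=
  .ofIic T.Edge (fun α => (finite_Iic α).toFinset) fun α β => by simp

/-- The sum of `f` over the geodesic from the root which ends with `α`. -/
noncomputable def pathSum {M : Type*} [AddCommMonoid M] (f : T.Edge → M) (α : T.Edge) : M :=
  ∑ β ∈ Finset.Iic α, f β

theorem pathSum_bot {M : Type*} [AddCommMonoid M] (f : T.Edge → M) : pathSum f ⊥ = f ⊥ := by
  have : Finset.Iic (⊥ : T.Edge) = {⊥} := by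
    ext β
    rw [Finset.mem_Iic, Finset.mem_singleton, le_bot_iff_eq_bot]
  rw [pathSum, this, Finset.sum_singleton]

theorem pathSum_child {M : Type*} [AddCommMonoid M] (f : T.Edge → M) {α β : T.Edge}
    (h : β.b = α.e) : pathSum f β = f β + pathSum f α := by
  classical
  have hIic : Finset.Iic β = insert β (Finset.Iic α) := by
    ext γ
    rw [Finset.mem_insert, Finset.mem_Iic, Finset.mem_Iic, le_child_iff h]
  rw [pathSum, hIic, Finset.sum_insert fun hβ => (lt_child h).not_ge (Finset.mem_Iic.1 hβ), pathSum]

theorem pathSum_ofReal {f : T.Edge → ℝ} (hf : ∀ β, 0 ≤ f β) (α : T.Edge) :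
    pathSum (fun β => ENNReal.ofReal (f β)) α = ENNReal.ofReal (pathSum f α) :=
  (ENNReal.ofReal_sum_of_nonneg fun β _ => hf β).symm

end Edge

theorem finite_setOf_b_eq (v : V) : {β : T.Edge | β.b = v}.Finite := by
  refine Set.Finite.of_finite_image (f := Edge.e) ((T.locallyFinite v).subset ?_)
    fun α _ β _ h => Edge.eq_of_e_eq h
  rintro _ ⟨β, rfl, rfl⟩
  exact β.adj

/-- The edges which begin at the vertex `v`. The edges directly beyond `α` are `T.edgesFrom α.e`,
and `T.edgesFrom α.b` consists of `α` and its siblings. -/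
noncomputable def edgesFrom (T : PlantedTree V) (v : V) : Finset T.Edge :=
  (finite_setOf_b_eq v).toFinset

@[simp] theorem mem_edgesFrom {v : V} {β : T.Edge} : β ∈ T.edgesFrom v ↔ β.b = v :=
  (finite_setOf_b_eq v).mem_toFinset

instance : Countable T.Edge := by
  have hfin (n : ℕ) : {β : T.Edge | β.depth = n}.Finite := by
    induction n with
    | zero => exact (finite_setOf_b_eq T.root).subset fun β hβ => Edge.depth_eq_zero.1 hβ
    | succ n ih =>
      refine (ih.biUnion fun γ _ => finite_setOf_b_eq γ.e).subset
        fun β (hβ : β.depth = n + 1) => ?_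
      obtain rfl | ⟨γ, hγ⟩ := β.eq_bot_or_exists_parent
      · rw [Edge.depth_eq_zero.2 (Edge.b_eq_root_iff.2 rfl)] at hβ
        omega
      · exact Set.mem_biUnion (by simpa [Edge.depth_child hγ] using hβ) hγ
  rw [← Set.countable_univ_iff]
  exact (Set.countable_iUnion fun n => (hfin n).countable).mono fun α _ =>
    Set.mem_iUnion.2 ⟨α.depth, rfl⟩

/-- The sets of edges which are traversed by the maximal geodesics starting at the root. -/
structure IsBranch (S : Set T.Edge) : Prop where
  bot_mem : ⊥ ∈ S
  parent_mem : ∀ ⦃α β : T.Edge⦄, β.b = α.e → β ∈ S → α ∈ S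
  exists_child : ∀ ⦃α⦄, α ∈ S → ¬ α.IsLeaf → ∃ β ∈ S, β.b = α.e
  eq_of_b_eq : ∀ ⦃α⦄, α ∈ S → ∀ ⦃β⦄, β ∈ S → α.b = β.b → α = β

namespace IsBranch

variable {S : Set T.Edge}

theorem mem_of_le (hS : IsBranch S) {α β : T.Edge} (h : α ≤ β) (hβ : β ∈ S) : α ∈ S := by
  induction β using Edge.induction_children with
  | bot => exact Edge.le_bot_iff_eq_bot.1 h ▸ hS.bot_mem
  | child γ β hb ih =>
    obtain rfl | h := (Edge.le_child_iff hb).1 h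
    exacts [hβ, ih h (hS.parent_mem hb hβ)]

theorem total (hS : IsBranch S) {α β : T.Edge} (hα : α ∈ S) (hβ : β ∈ S) : α ≤ β ∨ β ≤ α := by
  obtain h | h | ⟨α', β', hb, hne, hα', hβ'⟩ := Edge.comparable_or_exists_siblings α β
  · exact .inl h
  · exact .inr h
  · exact absurd (hS.eq_of_b_eq (hS.mem_of_le hα' hα) (hS.mem_of_le hβ' hβ) hb) hne

theorem pred_leaf_eq (hS : IsBranch S) {α : T.Edge} (hα : α ∈ S) (hl : α.IsLeaf) :
    T.pred (.leaf α hl) = S := by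
  ext β
  refine ⟨fun h => hS.mem_of_le h hα, fun hβ => ?_⟩
  obtain h | h := hS.total hα hβ
  exacts [hl β h ▸ le_refl α, h]

theorem exists_pred_ray_eq (hS : IsBranch S) (hl : ∀ α ∈ S, ¬ α.IsLeaf) :
    ∃ r zero adj inj, T.pred (.ray r zero adj inj) = S := by
  choose! next next_mem b_next using fun α hα => hS.exists_child hα (hl α hα)
  let a (n : ℕ) : T.Edge := next^[n] ⊥
  have a_succ (n : ℕ) : a (n + 1) = next (a n) := Function.iterate_succ_apply' next n ⊥
  have a_mem (n : ℕ) : a n ∈ S := by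
    induction n with
    | zero => exact hS.bot_mem
    | succ n ih => exact a_succ n ▸ next_mem _ ih
  have b_a_succ (n : ℕ) : (a (n + 1)).b = (a n).e := by rw [a_succ, b_next _ (a_mem n)]
  have depth_a (n : ℕ) : (a n).depth = n := by
    induction n with
    | zero => exact Edge.depth_eq_zero.2 (Edge.b_eq_root_iff.2 rfl)
    | succ n ih => rw [Edge.depth_child (b_a_succ n), ih]
  have a_depth {β : T.Edge} (hβ : β ∈ S) : a β.depth = β := by
    induction β using Edge.induction_children with
    | bot => rw [Edge.depth_eq_zero.2 (Edge.b_eq_root_iff.2 rfl)]; rfl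
    | child γ β hb ih =>
      refine hS.eq_of_b_eq (a_mem _) hβ ?_
      rw [Edge.depth_child hb, b_a_succ, ih (hS.parent_mem hb hβ), hb]
  refine ⟨fun n => (a n).b, Edge.b_eq_root_iff.2 rfl,
    fun n => by simpa only [b_a_succ] using (a n).adj, fun m n h => ?_,
    Set.ext fun β => ⟨?_, fun hβ => ?_⟩⟩
  · rw [← depth_a m, ← depth_a n]
    exact congrArg (T.graph.dist T.root) h
  · rintro ⟨n, -, h⟩
    exact Edge.eq_of_e_eq (h.trans (b_a_succ n)) ▸ a_mem n
  · have h := a_depth hβ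
    exact ⟨β.depth, congrArg Edge.b h.symm, (congrArg Edge.e h.symm).trans (b_a_succ _).symm⟩

theorem exists_pred_eq (hS : IsBranch S) : ∃ ζ : T.Boundary, T.pred ζ = S := by
  by_cases hl : ∃ α ∈ S, α.IsLeaf
  · obtain ⟨α, hα, hl⟩ := hl
    exact ⟨.leaf α hl, hS.pred_leaf_eq hα hl⟩
  · push Not at hl
    obtain ⟨r, zero, adj, inj, h⟩ := hS.exists_pred_ray_eq hl
    exact ⟨.ray r zero adj inj, h⟩

end IsBranch

theorem dist_ray {r : ℕ → V} (zero : r 0 = T.root) (adj : ∀ n, T.graph.Adj (r n) (r (n + 1)))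
    (inj : Function.Injective r) (n : ℕ) : T.graph.dist T.root (r n) = n := by
  induction n using Nat.twoStepInduction with
  | zero => rw [zero, SimpleGraph.dist_self]
  | one => rw [SimpleGraph.dist_eq_one_iff_adj, ← zero]; exact adj 0
  | more n ih₀ ih₁ =>
    refine (T.isTree.dist_eq_dist_add_one_of_adj T.root (adj (n + 1))).elim (fun h => ?_)
      fun h => by rw [h, ih₁]
    -- Otherwise the edges from `r n` and from `r (n + 2)` would both end at `r (n + 1)`.
    let α : T.Edge := ⟨r n, r (n + 1), adj n, by omega⟩
    let β : T.Edge := ⟨r (n + 2), r (n + 1), (adj (n + 1)).symm, by rw [h]; exact Nat.lt_add_one _⟩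
    have hαβ : α = β := Edge.eq_of_e_eq rfl
    have := inj (congrArg Edge.b hαβ)
    omega

theorem isBranch_pred_leaf {l : T.Edge} (hl : l.IsLeaf) : IsBranch (T.pred (.leaf l hl)) where
  bot_mem := bot_le (a := l)
  parent_mem _ _ h hβ := (Edge.lt_child h).le.trans (c := l) hβ
  exists_child α hα h := by
    obtain rfl | ⟨γ, hb, hγ⟩ := Edge.eq_or_exists_child_le hα
    exacts [absurd hl h, ⟨γ, hγ, hb⟩]
  eq_of_b_eq α hα β hβ h := by
    by_contra hne
    exact Edge.not_le_and_le_of_siblings h hne ⟨hα, hβ⟩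

theorem isBranch_pred_ray {r : ℕ → V} (zero : r 0 = T.root)
    (adj : ∀ n, T.graph.Adj (r n) (r (n + 1))) (inj : Function.Injective r) :
    IsBranch (T.pred (.ray r zero adj inj)) := by
  have hd := dist_ray zero adj inj
  let a (n : ℕ) : T.Edge := ⟨r n, r (n + 1), adj n, by rw [hd, hd]; omega⟩
  have hpred : T.pred (.ray r zero adj inj) = Set.range a := by
    ext α
    refine ⟨fun ⟨n, _, he⟩ => ⟨n, Edge.eq_of_e_eq he.symm⟩, ?_⟩
    rintro ⟨n, rfl⟩
    exact ⟨n, rfl, rfl⟩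
  rw [hpred]
  refine ⟨⟨0, Edge.b_eq_root_iff.1 zero⟩, ?_, ?_, ?_⟩
  · rintro α _ h ⟨_ | n, rfl⟩
    · exact absurd (h.symm.trans zero) α.e_ne_root
    · exact ⟨n, Edge.eq_of_e_eq h⟩
  · rintro _ ⟨n, rfl⟩ -
    exact ⟨a (n + 1), ⟨n + 1, rfl⟩, rfl⟩
  · rintro _ ⟨n, rfl⟩ _ ⟨m, rfl⟩ h
    rw [inj h]

theorem isBranch_pred (ζ : T.Boundary) : IsBranch (T.pred ζ) := by
  cases ζ with
  | leaf l hl => exact isBranch_pred_leaf hl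
  | ray r zero adj inj => exact isBranch_pred_ray zero adj inj

theorem potential_eq_iSup (f : T.Edge → ℝ≥0∞) (ζ : T.Boundary) :
    T.potential f ζ = ⨆ α : T.pred ζ, Edge.pathSum f α := by
  have hS := isBranch_pred ζ
  have pathSum_eq (α : T.pred ζ) : Edge.pathSum f α = ∑' β : Set.Iic (α : T.Edge), f β := by
    rw [Edge.pathSum, ← Finset.tsum_subtype', Finset.coe_Iic]
  apply le_antisymm
  · have : Nonempty (T.pred ζ) := ⟨⟨⊥, hS.bot_mem⟩⟩
    have : IsDirectedOrder (T.pred ζ) := ⟨fun α β =>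
      (hS.total α.2 β.2).elim (fun h => ⟨β, h, le_rfl⟩) fun h => ⟨α, le_rfl, h⟩⟩
    rw [potential, ENNReal.tsum_eq_iSup_sum]
    refine iSup_le fun s => ?_
    obtain ⟨α, hα⟩ := s.exists_le
    calc ∑ β ∈ s, f β = ∑ β ∈ s.map (Function.Embedding.subtype _), f β :=
          (Finset.sum_map s (Function.Embedding.subtype _) f).symm
      _ ≤ Edge.pathSum f α := Finset.sum_le_sum_of_subset fun β hβ => ?_
      _ ≤ _ := le_iSup (fun α : T.pred ζ => Edge.pathSum f α) α
    obtain ⟨γ, hγ, rfl⟩ := Finset.mem_map.1 hβ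
    exact Finset.mem_Iic.2 (hα γ hγ)
  · refine iSup_le fun α => ?_
    rw [pathSum_eq]
    exact ENNReal.tsum_mono_subtype f fun β hβ => hS.mem_of_le hβ α.2

@[simp] theorem mem_tentBoundary {α : T.Edge} {ζ : T.Boundary} :
    ζ ∈ T.tentBoundary α ↔ α ∈ T.pred ζ := Iff.rfl

theorem tentBoundary_bot : T.tentBoundary ⊥ = Set.univ :=
  Set.eq_univ_of_forall fun ζ => (isBranch_pred ζ).bot_mem

theorem tentBoundary_antitone : Antitone T.tentBoundary :=
  fun _ _ h ζ hζ => (isBranch_pred ζ).mem_of_le h hζ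

theorem isOpen_tentBoundary (α : T.Edge) : IsOpen (T.tentBoundary α) :=
  TopologicalSpace.isOpen_generateFrom_of_mem ⟨α, rfl⟩

theorem IsBranch.exists_mem_forall_notMem {S : Set T.Edge} (hS : IsBranch S) {α : T.Edge}
    (hα : α ∉ S) : ∃ γ ∈ S, ∀ S', IsBranch S' → γ ∈ S' → α ∉ S' := by
  induction α using Edge.induction_children with
  | bot => exact absurd hS.bot_mem hα
  | child β α h ih =>
    by_cases hβ : β ∈ S
    · obtain ⟨γ, hγ, hb⟩ := hS.exists_child hβ fun hl => Edge.isLeaf_iff.1 hl α h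
      refine ⟨γ, hγ, fun S' hS' hγ' hα' => hα ?_⟩
      rwa [hS'.eq_of_b_eq hα' hγ' (h.trans hb.symm)]
    · obtain ⟨γ, hγ, h'⟩ := ih hβ
      exact ⟨γ, hγ, fun S' hS' hγ' hα' => h' S' hS' hγ' (hS'.parent_mem h hα')⟩

theorem isClosed_tentBoundary (α : T.Edge) : IsClosed (T.tentBoundary α) := by
  rw [← isOpen_compl_iff, isOpen_iff_mem_nhds]
  intro ζ hζ
  obtain ⟨γ, hγ, h⟩ := (isBranch_pred ζ).exists_mem_forall_notMem hζ
  filter_upwards [(isOpen_tentBoundary γ).mem_nhds hγ] with ξ hξ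
  exact h _ (isBranch_pred ξ) hξ

instance : SecondCountableTopology T.Boundary :=
  ⟨⟨_, Set.countable_range T.tentBoundary, rfl⟩⟩

instance : RegularSpace T.Boundary := by
  rw [regularSpace_generateFrom (s := Set.range T.tentBoundary) rfl]
  rintro _ ⟨α, rfl⟩ ζ hζ
  rw [(isClosed_tentBoundary α).isOpen_compl.nhdsSet_eq, Filter.disjoint_principal_left,
    compl_compl]
  exact (isOpen_tentBoundary α).mem_nhds hζ

theorem measurableSet_tentBoundary (α : T.Edge) : MeasurableSet (T.tentBoundary α) :=
  (isOpen_tentBoundary α).measurableSet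

theorem borel_boundary_eq_generateFrom :
    borel T.Boundary = MeasurableSpace.generateFrom (Set.range T.tentBoundary) :=
  borel_eq_generateFrom_of_subbasis rfl

theorem isPiSystem_range_tentBoundary : IsPiSystem (Set.range T.tentBoundary) := by
  rintro _ ⟨α, rfl⟩ _ ⟨β, rfl⟩ ⟨ζ, hα, hβ⟩
  obtain h | h := (isBranch_pred ζ).total hα hβ
  · exact ⟨β, (Set.inter_eq_right.2 (tentBoundary_antitone h)).symm⟩
  · exact ⟨α, (Set.inter_eq_left.2 (tentBoundary_antitone h)).symm⟩

theorem copotential_bot (μ : Measure T.Boundary) : T.copotential μ ⊥ = μ Set.univ := by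
  rw [copotential, tentBoundary_bot]

theorem copotential_injective {μ ν : Measure T.Boundary} [IsFiniteMeasure μ]
    (h : T.copotential μ = T.copotential ν) : μ = ν := by
  refine ext_of_generate_finite _ borel_boundary_eq_generateFrom isPiSystem_range_tentBoundary ?_ ?_
  · rintro _ ⟨α, rfl⟩
    exact congrFun h α
  · rw [← copotential_bot, h, copotential_bot]

theorem potential_eq_tsum_indicator (f : T.Edge → ℝ≥0∞) (ζ : T.Boundary) :
    T.potential f ζ = ∑' α, (T.tentBoundary α).indicator (fun _ => f α) ζ := by
  rw [potential, tsum_subtype]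
  rfl

theorem measurable_potential (f : T.Edge → ℝ≥0∞) : Measurable (T.potential f) := by
  rw [funext (potential_eq_tsum_indicator f)]
  exact Measurable.tsum fun α => measurable_const.indicator (measurableSet_tentBoundary α)

theorem lintegral_potential (f : T.Edge → ℝ≥0∞) (μ : Measure T.Boundary) :
    ∫⁻ ζ, T.potential f ζ ∂μ = ∑' α, f α * T.copotential μ α := by
  simp_rw [potential_eq_tsum_indicator]
  rw [lintegral_tsum fun α =>
    (measurable_const.indicator (measurableSet_tentBoundary α)).aemeasurable]
  congr 1 with α
  rw [lintegral_indicator_const (measurableSet_tentBoundary α), copotential]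

theorem potential_mono {f g : T.Edge → ℝ≥0∞} (h : f ≤ g) : T.potential f ≤ T.potential g :=
  fun _ => ENNReal.tsum_le_tsum fun α => h α

theorem potential_add (f g : T.Edge → ℝ≥0∞) :
    T.potential (f + g) = T.potential f + T.potential g :=
  funext fun _ => ENNReal.tsum_add

theorem potential_const_mul (c : ℝ≥0∞) (f : T.Edge → ℝ≥0∞) (ζ : T.Boundary) :
    T.potential (fun α => c * f α) ζ = c * T.potential f ζ :=
  ENNReal.tsum_mul_left

section PartialSums

variable {ι κ M : Type*} [LinearOrder κ] [AddCommMonoid M] {r : ι → κ} {m : ι → M} {s : Finset ι}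

theorem exists_mem_Ico_sum_filter_lt [LinearOrder M] (hr : Function.Injective r) {t : M}
    (h0 : 0 ≤ t) (ht : t < ∑ i ∈ s, m i) :
    ∃ i ∈ s, t ∈ Set.Ico (∑ j ∈ s with r j < r i, m j) (∑ j ∈ s with r j < r i, m j + m i) := by
  classical
  induction s using Finset.induction_on_max_value r with
  | empty => exact absurd h0 (by simpa using ht)
  | insert a s ha hmax ih =>
    have hlt : ∀ x ∈ s, r x < r a := fun x hx =>
      lt_of_le_of_ne (hmax x hx) fun h => ha (hr h ▸ hx)
    by_cases hs : t < ∑ i ∈ s, m i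
    · obtain ⟨i, hi, h⟩ := ih hs
      refine ⟨i, Finset.mem_insert_of_mem hi, ?_⟩
      rwa [Finset.filter_insert, if_neg (hlt i hi).not_gt]
    · refine ⟨a, Finset.mem_insert_self _ _, ?_⟩
      rw [Finset.filter_insert, if_neg (lt_irrefl _), Finset.filter_true_of_mem hlt, add_comm,
        ← Finset.sum_insert ha]
      exact ⟨not_lt.1 hs, ht⟩

variable [PartialOrder M] [IsOrderedAddMonoid M]

theorem sum_filter_lt_add_le_sum (hm : ∀ i, 0 ≤ m i) {i : ι} (hi : i ∈ s) :
    ∑ j ∈ s with r j < r i, m j + m i ≤ ∑ j ∈ s, m j := by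
  classical
  rw [add_comm, ← Finset.sum_insert (by simp)]
  exact Finset.sum_le_sum_of_subset_of_nonneg
    (Finset.insert_subset hi (Finset.filter_subset _ _)) fun j _ _ => hm j

theorem sum_filter_lt_add_le_sum_filter_lt (hm : ∀ i, 0 ≤ m i) {i k : ι} (hi : i ∈ s)
    (hik : r i < r k) : ∑ j ∈ s with r j < r i, m j + m i ≤ ∑ j ∈ s with r j < r k, m j := by
  have hfilter : {j ∈ s | r j < r i} = {j ∈ {j ∈ s | r j < r k} | r j < r i} := by
    rw [Finset.filter_filter]
    exact Finset.filter_congr fun j _ => ⟨fun h => ⟨h.trans hik, h⟩, And.right⟩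
  rw [hfilter]
  exact sum_filter_lt_add_le_sum hm (Finset.mem_filter.2 ⟨hi, hik⟩)

end PartialSums

/-- A nonnegative function on the edges which is conserved at every interior vertex. -/
structure IsFlow (m : T.Edge → ℝ) : Prop where
  nonneg : ∀ α, 0 ≤ m α
  sum_edgesFrom : ∀ α : T.Edge, ¬ α.IsLeaf → ∑ β ∈ T.edgesFrom α.e, m β = m α

namespace Edge

/-- An enumeration of the edges, used to order the edges with a common beginning. -/
noncomputable def rank : T.Edge → ℕ := (exists_injective_nat T.Edge).choose

theorem rank_injective : Function.Injective (rank : T.Edge → ℕ) :=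
  (exists_injective_nat T.Edge).choose_spec

/-- The flow through the siblings of `α` which precede it in the enumeration. -/
noncomputable def offset (m : T.Edge → ℝ) (α : T.Edge) : ℝ :=
  ∑ β ∈ T.edgesFrom α.b with β.rank < α.rank, m β

/-- The left end of the interval of length `m α` which the flow `m` assigns to `α`: the intervals
of the edges directly beyond `α` subdivide the one of `α` from left to right. -/
noncomputable def left (m : T.Edge → ℝ) (α : T.Edge) : ℝ := pathSum (offset m) α

/-- The interval which the flow `m` assigns to `α`. -/
def interval (m : T.Edge → ℝ) (α : T.Edge) : Set ℝ := Set.Ico (left m α) (left m α + m α)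

theorem left_bot (m : T.Edge → ℝ) : left m ⊥ = 0 := by
  rw [left, pathSum_bot, offset, Finset.sum_eq_zero]
  intro β hβ
  rw [Finset.mem_filter, mem_edgesFrom, b_eq_root_iff.2 rfl, b_eq_root_iff] at hβ
  exact absurd hβ.2 (hβ.1 ▸ lt_irrefl _)

theorem left_child (m : T.Edge → ℝ) {α β : T.Edge} (h : β.b = α.e) :
    left m β = left m α + offset m β := by
  rw [left, pathSum_child _ h, left, add_comm]

theorem left_sub_left_of_siblings (m : T.Edge → ℝ) {α β : T.Edge} (h : α.b = β.b) :
    left m β - left m α = offset m β - offset m α := by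
  obtain rfl | ⟨γ, hγ⟩ := α.eq_bot_or_exists_parent
  · rw [b_eq_root_iff.1 (h.symm.trans (b_eq_root_iff.2 rfl))]
    ring
  · rw [left_child m hγ, left_child m (h.symm.trans hγ)]
    ring

theorem left_add_le_left_of_rank_lt {m : T.Edge → ℝ} (hm : ∀ α, 0 ≤ m α) {α β : T.Edge}
    (h : α.b = β.b) (hr : α.rank < β.rank) : left m α + m α ≤ left m β := by
  have hsub := left_sub_left_of_siblings m h
  have hle : offset m α + m α ≤ offset m β := by
    rw [offset, offset, ← h]
    exact sum_filter_lt_add_le_sum_filter_lt hm (mem_edgesFrom.2 rfl) hr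
  linarith

end Edge

namespace IsFlow

open Edge

variable {m : T.Edge → ℝ}

theorem left_le_left (hm : IsFlow m) {α β : T.Edge} (h : β.b = α.e) : left m α ≤ left m β := by
  rw [left_child m h]
  exact le_add_of_nonneg_right (Finset.sum_nonneg fun γ _ => hm.nonneg γ)

theorem right_le_right (hm : IsFlow m) {α β : T.Edge} (h : β.b = α.e) :
    left m β + m β ≤ left m α + m α := by
  rw [left_child m h, add_assoc, offset, h, ← hm.sum_edgesFrom α fun hl => isLeaf_iff.1 hl β h]
  gcongr
  exact sum_filter_lt_add_le_sum hm.nonneg (mem_edgesFrom.2 h)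

theorem left_add_le_left_or (hm : IsFlow m) {α β : T.Edge} (h : α.b = β.b) (hne : α ≠ β) :
    left m α + m α ≤ left m β ∨ left m β + m β ≤ left m α :=
  (rank_injective.ne hne).lt_or_gt.imp (left_add_le_left_of_rank_lt hm.nonneg h)
    (left_add_le_left_of_rank_lt hm.nonneg h.symm)

theorem interval_antitone (hm : IsFlow m) : Antitone (interval m) :=
  antitone_of_child fun _ _ h => Set.Ico_subset_Ico (hm.left_le_left h) (hm.right_le_right h)

theorem exists_child_mem_interval (hm : IsFlow m) {α : T.Edge} (hl : ¬ α.IsLeaf) {t : ℝ}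
    (ht : t ∈ interval m α) : ∃ β : T.Edge, t ∈ interval m β ∧ β.b = α.e := by
  have hlt : t - left m α < ∑ β ∈ T.edgesFrom α.e, m β := by
    rw [hm.sum_edgesFrom α hl]
    linarith [ht.2]
  obtain ⟨β, hβ, hge, hlt⟩ :=
    exists_mem_Ico_sum_filter_lt rank_injective (sub_nonneg.2 ht.1) hlt
  rw [mem_edgesFrom] at hβ
  rw [← hβ] at hge hlt
  refine ⟨β, ⟨?_, ?_⟩, hβ⟩ <;> rw [left_child m hβ, offset] <;> linarith

theorem isBranch_setOf_mem_interval (hm : IsFlow m) {t : ℝ} (ht : t ∈ interval m ⊥) :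
    IsBranch {α : T.Edge | t ∈ interval m α} where
  bot_mem := ht
  parent_mem _ _ h hβ := hm.interval_antitone (lt_child h).le hβ
  exists_child _ hα hl := hm.exists_child_mem_interval hl hα
  eq_of_b_eq α hα β hβ h := by
    by_contra hne
    obtain h | h := hm.left_add_le_left_or h hne
    · exact (hα.2.trans_le (h.trans hβ.1)).false
    · exact (hβ.2.trans_le (h.trans hα.1)).false

theorem exists_copotential_eq (hm : IsFlow m) :
    ∃ μ : Measure T.Boundary, T.copotential μ = fun α => ENNReal.ofReal (m α) := by
  choose Φ hΦ using fun t : interval m ⊥ => (hm.isBranch_setOf_mem_interval t.2).exists_pred_eq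
  have hpre (α : T.Edge) : Φ ⁻¹' T.tentBoundary α = Subtype.val ⁻¹' interval m α := by
    ext t
    rw [Set.mem_preimage, mem_tentBoundary, hΦ]
    rfl
  have hmeas (α : T.Edge) : MeasurableSet (interval m α) := measurableSet_Ico
  have hΦm : Measurable Φ := by
    refine (measurable_generateFrom ?_).mono le_rfl borel_boundary_eq_generateFrom.le
    rintro _ ⟨α, rfl⟩
    exact hpre α ▸ measurable_subtype_coe (hmeas α)
  refine ⟨((volume : Measure ℝ).comap Subtype.val).map Φ, funext fun α => ?_⟩
  rw [copotential, Measure.map_apply hΦm (measurableSet_tentBoundary α), hpre,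
    comap_subtype_coe_apply (hmeas ⊥), Subtype.image_preimage_coe,
    Set.inter_eq_right.2 (hm.interval_antitone bot_le), interval, Real.volume_Ico,
    add_sub_cancel_left]

end IsFlow

section Capacity

theorem capacity_le_of_potential {E : Set T.Boundary} {f : T.Edge → ℝ≥0∞}
    (h : ∀ ζ ∈ E, 1 ≤ T.potential f ζ) : T.capacity E ≤ ∑' α, f α ^ 2 :=
  iInf₂_le f h

theorem capacity_mono {E F : Set T.Boundary} (h : E ⊆ F) : T.capacity E ≤ T.capacity F :=
  le_iInf₂ fun _ hf => capacity_le_of_potential fun ζ hζ => hf ζ (h hζ)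

theorem capacity_empty : T.capacity (∅ : Set T.Boundary) = 0 :=
  le_antisymm ((capacity_le_of_potential (f := 0) (by simp)).trans_eq (by simp)) zero_le

theorem capacity_iUnion_le (E : ℕ → Set T.Boundary) :
    T.capacity (⋃ n, E n) ≤ ∑' n, T.capacity (E n) := by
  refine ENNReal.le_of_forall_pos_le_add fun ε hε hfin => ?_
  obtain ⟨δ, hδ, hsum⟩ := ENNReal.exists_pos_sum_of_countable' (ENNReal.coe_ne_zero.2 hε.ne') ℕ
  have hadm (n : ℕ) : ∃ f : T.Edge → ℝ≥0∞,
      (∀ ζ ∈ E n, 1 ≤ T.potential f ζ) ∧ ∑' α, f α ^ 2 < T.capacity (E n) + δ n := by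
    simpa only [capacity, iInf_lt_iff, exists_prop] using
      ENNReal.lt_add_right (ENNReal.ne_top_of_tsum_ne_top hfin.ne n) (hδ n).ne'
  choose f hf hfδ using hadm
  have hsup : ∀ ζ ∈ ⋃ n, E n, 1 ≤ T.potential (⨆ n, f n) ζ := fun ζ hζ => by
    obtain ⟨n, hn⟩ := Set.mem_iUnion.1 hζ
    exact (hf n ζ hn).trans (potential_mono (le_iSup f n) ζ)
  calc T.capacity (⋃ n, E n) ≤ ∑' α, (⨆ n, f n) α ^ 2 := capacity_le_of_potential hsup
    _ ≤ ∑' α, ∑' n, f n α ^ 2 := ENNReal.tsum_le_tsum fun α => by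
        rw [iSup_apply, ENNReal.iSup_pow]
        exact iSup_le fun n => ENNReal.le_tsum n
    _ = ∑' n, ∑' α, f n α ^ 2 := ENNReal.tsum_comm
    _ ≤ ∑' n, (T.capacity (E n) + δ n) := ENNReal.tsum_le_tsum fun n => (hfδ n).le
    _ ≤ ∑' n, T.capacity (E n) + ε := by
        rw [ENNReal.tsum_add]
        gcongr

variable (T) in
/-- The capacity as an outer measure, so that quasi-everywhere, that is, outside a set of zero
capacity, becomes `∀ᵐ ζ ∂T.capacityOuterMeasure`. -/
noncomputable def capacityOuterMeasure : OuterMeasure T.Boundary where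
  measureOf := T.capacity
  empty := capacity_empty
  mono := capacity_mono
  iUnion_nat E _ := capacity_iUnion_le E

theorem capacity_setOf_le_potential_le {c : ℝ≥0∞} (hc : c ≠ 0) (hc' : c ≠ ∞)
    (f : T.Edge → ℝ≥0∞) :
    T.capacity {ζ | c ≤ T.potential f ζ} ≤ c⁻¹ ^ 2 * ∑' α, f α ^ 2 := by
  calc T.capacity {ζ | c ≤ T.potential f ζ} ≤ ∑' α, (c⁻¹ * f α) ^ 2 :=
        capacity_le_of_potential fun ζ hζ => by
          rw [potential_const_mul, ← ENNReal.inv_mul_cancel hc hc']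
          gcongr
          exact hζ
    _ = c⁻¹ ^ 2 * ∑' α, f α ^ 2 := by
        simp_rw [mul_pow]
        exact ENNReal.tsum_mul_left

end Capacity

variable (T) in
/-- The Hilbert space of square summable functions on the edges. -/
abbrev EdgeL2 : Type _ := lp (fun _ : T.Edge => ℝ) 2

namespace EdgeL2

theorem tsum_ofReal_abs_sq (f : T.EdgeL2) :
    ∑' α, ENNReal.ofReal |f α| ^ 2 = ENNReal.ofReal (‖f‖ ^ 2) := by
  have h := lp.hasSum_norm (p := 2) (by norm_num) f
  simp only [ENNReal.toReal_ofNat, Real.rpow_ofNat, Real.norm_eq_abs] at h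
  rw [← h.tsum_eq, ENNReal.ofReal_tsum_of_nonneg (fun α => by positivity) h.summable]
  simp_rw [ENNReal.ofReal_pow (abs_nonneg _)]

theorem tsum_ofReal_sq_le (f : T.EdgeL2) :
    ∑' α, ENNReal.ofReal (f α) ^ 2 ≤ ENNReal.ofReal (‖f‖ ^ 2) := by
  rw [← tsum_ofReal_abs_sq]
  gcongr
  exact le_abs_self _

theorem tsum_ofReal_sq {f : T.EdgeL2} (hf : ∀ α, 0 ≤ f α) :
    ∑' α, ENNReal.ofReal (f α) ^ 2 = ENNReal.ofReal (‖f‖ ^ 2) := by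
  rw [← tsum_ofReal_abs_sq]
  simp_rw [abs_of_nonneg (hf _)]

theorem exists_ofReal_eq {f : T.Edge → ℝ≥0∞} (hf : ∑' α, f α ^ 2 ≠ ∞) :
    ∃ g : T.EdgeL2, (∀ α, 0 ≤ g α) ∧ (fun α => ENNReal.ofReal (g α)) = f := by
  have hfin (α : T.Edge) : f α ≠ ∞ := fun h => by
    simpa [h] using ENNReal.ne_top_of_tsum_ne_top hf α
  have hmem : Memℓp (E := fun _ : T.Edge => ℝ) (fun α => (f α).toReal) 2 := by
    refine memℓp_gen ?_
    simpa only [ENNReal.toReal_ofNat, Real.rpow_ofNat, Real.norm_eq_abs, sq_abs,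
      ENNReal.toReal_pow] using ENNReal.summable_toReal hf
  exact ⟨⟨_, hmem⟩, fun _ => ENNReal.toReal_nonneg,
    funext fun α => ENNReal.ofReal_toReal (hfin α)⟩

/-- The potential of the positive part of `f`. -/
noncomputable def posPotential (f : T.EdgeL2) : T.Boundary → ℝ≥0∞ :=
  T.potential fun α => ENNReal.ofReal (f α)

theorem posPotential_add_le (f g : T.EdgeL2) :
    posPotential (f + g) ≤ posPotential f + posPotential g := by
  rw [posPotential, posPotential, posPotential, ← potential_add]
  exact potential_mono fun α => ENNReal.ofReal_add_le

theorem posPotential_add {f g : T.EdgeL2} (hf : ∀ α, 0 ≤ f α) (hg : ∀ α, 0 ≤ g α) :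
    posPotential (f + g) = posPotential f + posPotential g := by
  rw [posPotential, posPotential, posPotential, ← potential_add]
  exact congrArg T.potential (funext fun α => ENNReal.ofReal_add (hf α) (hg α))

theorem posPotential_smul {c : ℝ} (hc : 0 ≤ c) (f : T.EdgeL2) (ζ : T.Boundary) :
    posPotential (c • f) ζ = ENNReal.ofReal c * posPotential f ζ := by
  rw [posPotential, posPotential, ← potential_const_mul]
  exact congrFun (congrArg T.potential (funext fun α => ENNReal.ofReal_mul hc)) ζ

theorem capacity_setOf_le_posPotential_le {c : ℝ≥0∞} (hc : c ≠ 0) (hc' : c ≠ ∞) (f : T.EdgeL2) :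
    T.capacity {ζ | c ≤ posPotential f ζ} ≤ c⁻¹ ^ 2 * ENNReal.ofReal (‖f‖ ^ 2) :=
  (capacity_setOf_le_potential_le hc hc' _).trans (by
    gcongr
    exact tsum_ofReal_sq_le f)

open Classical in
/-- The indicator function of a finite set of edges. -/
noncomputable def indicator (s : Finset T.Edge) : T.EdgeL2 := ∑ α ∈ s, lp.single 2 α 1

open Classical in
theorem indicator_apply (s : Finset T.Edge) (α : T.Edge) :
    indicator s α = if α ∈ s then 1 else 0 := by
  rw [indicator, lp.coeFn_sum, Finset.sum_apply]
  simp [lp.single_apply, Pi.single_apply]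

theorem indicator_nonneg (s : Finset T.Edge) (α : T.Edge) : 0 ≤ indicator s α := by
  rw [indicator_apply]
  positivity

theorem inner_indicator (f : T.EdgeL2) (s : Finset T.Edge) :
    inner ℝ f (indicator s) = ∑ α ∈ s, f α := by
  rw [indicator, inner_sum]
  simp only [lp.inner_single_right, RCLike.inner_apply, conj_trivial, one_mul]

open Classical in
theorem posPotential_indicator (s : Finset T.Edge) (ζ : T.Boundary) :
    posPotential (indicator s) ζ = Finset.card {α ∈ s | α ∈ T.pred ζ} := by
  rw [posPotential, potential_eq_tsum_indicator, tsum_eq_sum (s := s) fun α hα => by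
    simp [indicator_apply, hα], Finset.card_filter, Nat.cast_sum]
  refine Finset.sum_congr rfl fun α hα => ?_
  simp [Set.indicator_apply, indicator_apply, hα, mem_tentBoundary]

theorem continuous_eval (α : T.Edge) : Continuous fun f : T.EdgeL2 => f α := by
  have h (f : T.EdgeL2) : f α = inner ℝ f (indicator {α}) := by simp [inner_indicator]
  simp_rw [h]
  fun_prop

end EdgeL2

section Equilibrium

open EdgeL2

variable {E : Set T.Boundary} {f g h : T.EdgeL2}

/-- The nonnegative square summable functions whose potential is at least one at quasi-every point
of `E`. Unlike the functions which are admissible in the definition of `c₂(E)` they form a closed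
set. -/
def quasiAdmissible (E : Set T.Boundary) : Set T.EdgeL2 :=
  {f | (∀ α, 0 ≤ f α) ∧ ∀ᵐ ζ ∂T.capacityOuterMeasure, ζ ∈ E → 1 ≤ posPotential f ζ}

theorem convex_quasiAdmissible (E : Set T.Boundary) : Convex ℝ (quasiAdmissible E) := by
  intro f ⟨hf, hfE⟩ g ⟨hg, hgE⟩ a b ha hb hab
  have haf (α : T.Edge) : 0 ≤ (a • f) α := mul_nonneg ha (hf α)
  have hbg (α : T.Edge) : 0 ≤ (b • g) α := mul_nonneg hb (hg α)
  refine ⟨fun α => add_nonneg (haf α) (hbg α), ?_⟩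
  filter_upwards [hfE, hgE] with ζ hfζ hgζ hζ
  calc (1 : ℝ≥0∞) = ENNReal.ofReal a * 1 + ENNReal.ofReal b * 1 := by
        rw [mul_one, mul_one, ← ENNReal.ofReal_add ha hb, hab, ENNReal.ofReal_one]
    _ ≤ ENNReal.ofReal a * posPotential f ζ + ENNReal.ofReal b * posPotential g ζ := by
        gcongr
        exacts [hfζ hζ, hgζ hζ]
    _ = posPotential (a • f + b • g) ζ := by
        rw [posPotential_add haf hbg, Pi.add_apply, posPotential_smul ha, posPotential_smul hb]

theorem capacity_setOf_posPotential_add_lt_le (hg : g ∈ quasiAdmissible E) {c : ℝ≥0∞} (hc : c ≠ 0)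
    (hc' : c ≠ ∞) : T.capacity {ζ ∈ E | posPotential f ζ + c < 1} ≤
      c⁻¹ ^ 2 * ENNReal.ofReal (‖g - f‖ ^ 2) := by
  refine le_trans ?_ (capacity_setOf_le_posPotential_le hc hc' (g - f))
  refine measure_mono_ae (μ := T.capacityOuterMeasure) ?_
  filter_upwards [hg.2] with ζ hgζ ⟨hζ, hlt⟩
  by_contra! hgf
  refine (hgζ hζ).not_gt ?_
  calc posPotential g ζ = posPotential (f + (g - f)) ζ := by rw [add_sub_cancel]
    _ ≤ posPotential f ζ + posPotential (g - f) ζ := posPotential_add_le f (g - f) ζ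
    _ ≤ posPotential f ζ + c := by gcongr; exact (not_le.1 hgf).le
    _ < 1 := hlt

theorem capacity_setOf_posPotential_add_lt_eq_zero (hf : f ∈ closure (quasiAdmissible E))
    {c : ℝ≥0∞} (hc : c ≠ 0) (hc' : c ≠ ∞) :
    T.capacity {ζ ∈ E | posPotential f ζ + c < 1} = 0 := by
  have hcont : Continuous fun g : T.EdgeL2 => c⁻¹ ^ 2 * ENNReal.ofReal (‖g - f‖ ^ 2) :=
    (ENNReal.continuous_const_mul (by finiteness)).comp
      (ENNReal.continuous_ofReal.comp (by fun_prop))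
  have hsub : quasiAdmissible E ⊆ {g | T.capacity {ζ ∈ E | posPotential f ζ + c < 1} ≤
      c⁻¹ ^ 2 * ENNReal.ofReal (‖g - f‖ ^ 2)} :=
    fun g hg => capacity_setOf_posPotential_add_lt_le hg hc hc'
  have hle := closure_minimal hsub (isClosed_le continuous_const hcont) hf
  simpa only [Set.mem_ofPred_eq, sub_self, norm_zero, ne_eq, OfNat.ofNat_ne_zero,
    not_false_eq_true, zero_pow, ENNReal.ofReal_zero, mul_zero, nonpos_iff_eq_zero] using hle

theorem isClosed_quasiAdmissible (E : Set T.Boundary) : IsClosed (quasiAdmissible E) := by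
  refine isClosed_of_closure_subset fun f hf => ⟨fun α => ?_, ?_⟩
  · have hsub : quasiAdmissible E ⊆ {g | 0 ≤ g α} := fun g hg => hg.1 α
    exact closure_minimal hsub (isClosed_le continuous_const (continuous_eval α)) hf
  have hae : ∀ᵐ ζ ∂T.capacityOuterMeasure, ∀ n : ℕ,
      ζ ∈ E → 1 ≤ posPotential f ζ + (n : ℝ≥0∞)⁻¹ := by
    refine ae_all_iff.2 fun n => ae_iff.2 ?_
    simp only [Classical.not_imp, not_le]
    obtain rfl | hn := eq_or_ne n 0
    · simp
    · exact capacity_setOf_posPotential_add_lt_eq_zero hf (by simp) (by simpa using hn)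
  filter_upwards [hae] with ζ h hζ
  have hlim := ENNReal.tendsto_inv_nat_nhds_zero.const_add (posPotential f ζ)
  rw [add_zero] at hlim
  exact ge_of_tendsto' hlim (h · hζ)

theorem indicator_bot_mem_quasiAdmissible (E : Set T.Boundary) :
    indicator {⊥} ∈ quasiAdmissible E := by
  refine ⟨indicator_nonneg _, .of_forall fun ζ _ => ?_⟩
  simp [posPotential_indicator, Finset.filter_singleton, (isBranch_pred ζ).bot_mem]

theorem capacity_le_norm_sq (hf : f ∈ quasiAdmissible E) :
    T.capacity E ≤ ENNReal.ofReal (‖f‖ ^ 2) := by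
  calc T.capacity E ≤ T.capacity {ζ | 1 ≤ posPotential f ζ} :=
        measure_mono_ae (μ := T.capacityOuterMeasure) hf.2
    _ ≤ 1⁻¹ ^ 2 * ENNReal.ofReal (‖f‖ ^ 2) :=
        capacity_setOf_le_posPotential_le one_ne_zero ENNReal.one_ne_top f
    _ = ENNReal.ofReal (‖f‖ ^ 2) := by simp

theorem capacity_ne_top (E : Set T.Boundary) : T.capacity E ≠ ∞ :=
  ne_top_of_le_ne_top ENNReal.ofReal_ne_top
    (capacity_le_norm_sq (indicator_bot_mem_quasiAdmissible E))

/-- `f` is the quasi-admissible function of least norm; it turns out to be the co-potential of the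
equilibrium measure. -/
structure IsEquilibriumFunction (E : Set T.Boundary) (f : T.EdgeL2) : Prop where
  mem : f ∈ quasiAdmissible E
  norm_sq : ENNReal.ofReal (‖f‖ ^ 2) = T.capacity E

theorem exists_isEquilibriumFunction (E : Set T.Boundary) :
    ∃ f, IsEquilibriumFunction E f := by
  obtain ⟨f, hf, hmin⟩ := exists_norm_eq_iInf_of_complete_convex
    ⟨_, indicator_bot_mem_quasiAdmissible E⟩ (isClosed_quasiAdmissible E).isComplete
    (convex_quasiAdmissible E) 0
  have hle (g : T.EdgeL2) (hg : g ∈ quasiAdmissible E) : ‖f‖ ≤ ‖g‖ := by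
    have hinf := ciInf_le (f := fun w : quasiAdmissible E => ‖0 - (w : T.EdgeL2)‖)
      ⟨0, Set.forall_mem_range.2 fun _ => norm_nonneg _⟩ ⟨g, hg⟩
    simpa using hmin.trans_le hinf
  refine ⟨f, hf, le_antisymm (le_iInf₂ fun F hF => ?_) (capacity_le_norm_sq hf)⟩
  by_cases htop : ∑' α, F α ^ 2 = ∞
  · exact htop ▸ le_top
  · obtain ⟨g, hg, rfl⟩ := exists_ofReal_eq htop
    rw [tsum_ofReal_sq hg]
    gcongr
    exact hle g ⟨hg, .of_forall hF⟩

namespace IsEquilibriumFunction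

theorem nonneg (hf : IsEquilibriumFunction E f) (α : T.Edge) : 0 ≤ f α :=
  hf.mem.1 α

theorem norm_le (hf : IsEquilibriumFunction E f) (hg : g ∈ quasiAdmissible E) : ‖f‖ ≤ ‖g‖ := by
  have h := hf.norm_sq.trans_le (capacity_le_norm_sq hg)
  rw [ENNReal.ofReal_le_ofReal_iff (by positivity)] at h
  exact le_of_sq_le_sq h (norm_nonneg _)

theorem norm_sq_le_inner (hf : IsEquilibriumFunction E f) (hg : g ∈ quasiAdmissible E) :
    ‖f‖ ^ 2 ≤ inner ℝ f g := by
  have : Nonempty (quasiAdmissible E) := ⟨⟨f, hf.mem⟩⟩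
  have hmin : ‖0 - f‖ = ⨅ w : quasiAdmissible E, ‖0 - (w : T.EdgeL2)‖ := by
    simp only [zero_sub, norm_neg]
    exact le_antisymm (le_ciInf fun w => hf.norm_le w.2)
      (ciInf_le (f := fun w : quasiAdmissible E => ‖(w : T.EdgeL2)‖)
        ⟨0, Set.forall_mem_range.2 fun _ => norm_nonneg _⟩ ⟨f, hf.mem⟩)
  have h := (norm_eq_iInf_iff_real_inner_le_zero (convex_quasiAdmissible E) hf.mem).1 hmin g hg
  rw [zero_sub, inner_neg_left, inner_sub_right, real_inner_self_eq_norm_sq] at h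
  linarith

theorem unique (hf : IsEquilibriumFunction E f) (hg : IsEquilibriumFunction E g) : f = g := by
  have hfg := hf.norm_sq_le_inner hg.mem
  have hgf := hg.norm_sq_le_inner hf.mem
  have hsub : ‖f - g‖ ^ 2 ≤ 0 := by
    rw [norm_sub_sq_real]
    linarith [real_inner_comm f g]
  rw [← sub_eq_zero, ← norm_eq_zero]
  exact pow_eq_zero_iff two_ne_zero |>.1 (hsub.antisymm (sq_nonneg _))

open Classical in
-- The competitor is `f - g + h` with `g = t • indicator s`; comparing it with `f + h` after adding
-- `g` back avoids subtracting potentials, which may be infinite.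
theorem mul_sum_le_inner (hf : IsEquilibriumFunction E f) {t : ℝ} (ht : 0 ≤ t) {s : Finset T.Edge}
    (hts : ∀ α ∈ s, t ≤ f α) (hh : ∀ α, 0 ≤ h α)
    (hE : ∀ ζ ∈ E, 1 ≤ posPotential f ζ →
      1 + ENNReal.ofReal t * Finset.card {α ∈ s | α ∈ T.pred ζ} ≤
        posPotential f ζ + posPotential h ζ) :
    t * ∑ α ∈ s, f α ≤ inner ℝ f h := by
  set g := t • indicator s with hg
  have hg0 (α : T.Edge) : 0 ≤ g α := mul_nonneg ht (indicator_nonneg s α)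
  have hgf (α : T.Edge) : g α ≤ f α := by
    rw [hg, lp.coeFn_smul, Pi.smul_apply, indicator_apply]
    split_ifs with hα
    · simpa using hts α hα
    · simpa using hf.nonneg α
  have hw (α : T.Edge) : 0 ≤ (f - g + h) α := add_nonneg (sub_nonneg.2 (hgf α)) (hh α)
  have hmem : f - g + h ∈ quasiAdmissible E := by
    refine ⟨hw, ?_⟩
    filter_upwards [hf.mem.2] with ζ hfζ hζ
    have hgζ : posPotential g ζ = ENNReal.ofReal t * Finset.card {α ∈ s | α ∈ T.pred ζ} := by
      rw [hg, posPotential_smul ht, posPotential_indicator]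
    refine (ENNReal.add_le_add_iff_right (a := posPotential g ζ) (by rw [hgζ]; finiteness)).1 ?_
    calc 1 + posPotential g ζ ≤ posPotential f ζ + posPotential h ζ := hgζ ▸ hE ζ hζ (hfζ hζ)
      _ = posPotential (f + h) ζ := by rw [posPotential_add hf.nonneg hh, Pi.add_apply]
      _ = posPotential (f - g + h + g) ζ := by rw [sub_add_eq_add_sub, sub_add_cancel]
      _ = posPotential (f - g + h) ζ + posPotential g ζ := by
        rw [posPotential_add hw hg0, Pi.add_apply]
  have hinner := hf.norm_sq_le_inner hmem
  rw [inner_add_right, inner_sub_right, real_inner_self_eq_norm_sq, hg, inner_smul_right,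
    inner_indicator] at hinner
  linarith

open Classical in
theorem sum_le_sum_of_card_le (hf : IsEquilibriumFunction E f) {s u : Finset T.Edge}
    (hs : ∀ α ∈ s, 0 < f α)
    (hsu : ∀ ζ, Finset.card {α ∈ s | α ∈ T.pred ζ} ≤ Finset.card {α ∈ u | α ∈ T.pred ζ}) :
    ∑ α ∈ s, f α ≤ ∑ α ∈ u, f α := by
  obtain ⟨t, ht, hts⟩ : ∃ t > 0, ∀ α ∈ s, t ≤ f α := by
    obtain rfl | hne := s.eq_empty_or_nonempty
    · exact ⟨1, one_pos, by simp⟩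
    · obtain ⟨α, hα, hmin⟩ := s.exists_min_image f hne
      exact ⟨f α, hs α hα, hmin⟩
  have hle : t * ∑ α ∈ s, f α ≤ inner ℝ f (t • indicator u) := by
    refine hf.mul_sum_le_inner ht.le hts (fun α => mul_nonneg ht.le (indicator_nonneg u α))
      fun ζ _ hζ => ?_
    rw [posPotential_smul ht.le, posPotential_indicator]
    gcongr ?_ + _ * ?_
    exact_mod_cast hsu ζ
  rw [inner_smul_right, inner_indicator] at hle
  exact le_of_mul_le_mul_left hle ht

theorem sum_edgesFrom_le (hf : IsEquilibriumFunction E f) (α : T.Edge) :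
    ∑ β ∈ T.edgesFrom α.e, f β ≤ f α := by
  classical
  rw [← Finset.sum_filter_of_ne fun β _ h => (hf.nonneg β).lt_of_ne' h, ← Finset.sum_singleton f α]
  refine hf.sum_le_sum_of_card_le (fun β hβ => (Finset.mem_filter.1 hβ).2) fun ζ => ?_
  have hS := isBranch_pred ζ
  refine Finset.card_le_card_of_injOn (fun _ => α) (fun β hβ => ?_) fun β hβ γ hγ _ => ?_
  · simp only [Finset.coe_filter, Finset.mem_filter, mem_edgesFrom, Set.mem_ofPred_eq] at hβ
    simpa using hS.parent_mem hβ.1.1 hβ.2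
  · simp only [Finset.coe_filter, Finset.mem_filter, mem_edgesFrom, Set.mem_ofPred_eq] at hβ hγ
    exact hS.eq_of_b_eq hβ.2 hγ.2 (hβ.1.1.trans hγ.1.1.symm)

theorem le_sum_edgesFrom (hf : IsEquilibriumFunction E f) {α : T.Edge} (hl : ¬ α.IsLeaf) :
    f α ≤ ∑ β ∈ T.edgesFrom α.e, f β := by
  classical
  obtain h0 | hpos := (hf.nonneg α).eq_or_lt
  · exact h0 ▸ Finset.sum_nonneg fun β _ => hf.nonneg β
  rw [← Finset.sum_singleton f α]
  refine hf.sum_le_sum_of_card_le (by simpa using hpos) fun ζ => ?_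
  rw [Finset.filter_singleton]
  split_ifs with hα
  · obtain ⟨β, hβ, hb⟩ := (isBranch_pred ζ).exists_child hα hl
    exact Finset.card_pos.2 ⟨β, Finset.mem_filter.2 ⟨mem_edgesFrom.2 hb, hβ⟩⟩
  · exact Nat.zero_le _

theorem isFlow (hf : IsEquilibriumFunction E f) : IsFlow f where
  nonneg := hf.nonneg
  sum_edgesFrom α hl := (hf.sum_edgesFrom_le α).antisymm (hf.le_sum_edgesFrom hl)

theorem norm_sq_eq_apply_bot (hf : IsEquilibriumFunction E f) : ‖f‖ ^ 2 = f ⊥ := by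
  refine le_antisymm ?_ ?_
  · simpa [inner_indicator] using hf.norm_sq_le_inner (indicator_bot_mem_quasiAdmissible E)
  obtain h0 | hpos := (hf.nonneg ⊥).eq_or_lt
  · exact h0 ▸ sq_nonneg _
  have hle : f ⊥ * ∑ α ∈ {⊥}, f α ≤ inner ℝ f (f ⊥ • f) := by
    refine hf.mul_sum_le_inner hpos.le (by simp) (fun α => mul_nonneg hpos.le (hf.nonneg α))
      fun ζ _ hζ => ?_
    rw [posPotential_smul hpos.le]
    gcongr
    rw [Finset.filter_singleton, if_pos (isBranch_pred ζ).bot_mem]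
    simpa using hζ
  rw [Finset.sum_singleton, inner_smul_right, real_inner_self_eq_norm_sq] at hle
  exact le_of_mul_le_mul_left hle hpos

theorem pathSum_le_one_of_pos (hf : IsEquilibriumFunction E f) {α : T.Edge} (hα : 0 < f α) :
    Edge.pathSum f α ≤ 1 := by
  by_contra! hlt
  obtain ⟨t, ht, htα, hsum⟩ : ∃ t > 0, t ≤ f α ∧ 1 + t ≤ Edge.pathSum f α :=
    ⟨min (f α) (Edge.pathSum f α - 1), lt_min hα (sub_pos.2 hlt), min_le_left _ _,
      le_sub_iff_add_le'.1 (min_le_right _ _)⟩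
  have hle : t * ∑ β ∈ {α}, f β ≤ inner ℝ f 0 := by
    refine hf.mul_sum_le_inner ht.le (by simpa using htα) (fun _ => le_rfl) fun ζ _ hζ => ?_
    refine le_trans ?_ le_self_add
    rw [Finset.filter_singleton]
    split_ifs with hαζ
    · calc 1 + ENNReal.ofReal t * Finset.card {α} = ENNReal.ofReal (1 + t) := by
            rw [Finset.card_singleton, Nat.cast_one, mul_one, ENNReal.ofReal_add zero_le_one ht.le,
              ENNReal.ofReal_one]
        _ ≤ ENNReal.ofReal (Edge.pathSum f α) := ENNReal.ofReal_le_ofReal hsum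
        _ = Edge.pathSum (fun β => ENNReal.ofReal (f β)) α :=
            (Edge.pathSum_ofReal hf.nonneg α).symm
        _ ≤ posPotential f ζ := by
            rw [posPotential, potential_eq_iSup]
            exact le_iSup (fun β : T.pred ζ => Edge.pathSum _ (β : T.Edge)) ⟨α, hαζ⟩
    · simpa using hζ
  rw [Finset.sum_singleton, inner_zero_right] at hle
  exact hle.not_gt (mul_pos ht hα)

theorem pathSum_le_one (hf : IsEquilibriumFunction E f) (α : T.Edge) : Edge.pathSum f α ≤ 1 := by
  induction α using Edge.induction_children with
  | bot =>
    obtain h0 | hpos := (hf.nonneg ⊥).eq_or_lt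
    · rw [Edge.pathSum_bot, ← h0]
      exact zero_le_one
    · exact hf.pathSum_le_one_of_pos hpos
  | child α β hβ ih =>
    obtain h0 | hpos := (hf.nonneg β).eq_or_lt
    · rwa [Edge.pathSum_child _ hβ, ← h0, zero_add]
    · exact hf.pathSum_le_one_of_pos hpos

theorem isEquilibriumMeasure (hf : IsEquilibriumFunction E f) {μ : Measure T.Boundary}
    (hμ : T.copotential μ = fun α => ENNReal.ofReal (f α)) : T.IsEquilibriumMeasure E μ where
  capacity_exceptional := by
    have hae := ae_iff.1 hf.mem.2
    simp only [Classical.not_imp, not_le] at hae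
    rwa [hμ]
  energy_eq := by rw [hμ, tsum_ofReal_sq hf.nonneg, hf.norm_sq]
  mass_eq := by rw [← copotential_bot, congrFun hμ, ← hf.norm_sq_eq_apply_bot, hf.norm_sq]

end IsEquilibriumFunction

theorem IsEquilibriumMeasure.exists_isEquilibriumFunction {μ : Measure T.Boundary}
    (hμ : T.IsEquilibriumMeasure E μ) :
    ∃ f, IsEquilibriumFunction E f ∧ T.copotential μ = fun α => ENNReal.ofReal (f α) := by
  obtain ⟨f, hf, hfμ⟩ := exists_ofReal_eq (hμ.energy_eq ▸ capacity_ne_top E)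
  refine ⟨f, ⟨⟨hf, ae_iff.2 ?_⟩, ?_⟩, hfμ.symm⟩
  · simp only [Classical.not_imp, not_le]
    rw [posPotential, hfμ]
    exact hμ.capacity_exceptional
  · rw [← tsum_ofReal_sq hf, ← hμ.energy_eq, ← hfμ]

theorem existsUnique_isEquilibriumMeasure (E : Set T.Boundary) :
    ∃! μ, T.IsEquilibriumMeasure E μ := by
  obtain ⟨f, hf⟩ := exists_isEquilibriumFunction E
  obtain ⟨μ, hμ⟩ := hf.isFlow.exists_copotential_eq
  refine ⟨μ, hf.isEquilibriumMeasure hμ, fun ν hν => ?_⟩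
  obtain ⟨g, hg, hgν⟩ := hν.exists_isEquilibriumFunction
  have : IsFiniteMeasure ν := ⟨by rw [hν.mass_eq]; exact (capacity_ne_top E).lt_top⟩
  exact copotential_injective (by rw [hgν, hμ, hf.unique hg])

theorem two_mul_mul_le_sq_add_sq {R : Type*} [CommSemiring R] [LinearOrder R]
    [CanonicallyOrderedAdd R] (a b : R) : 2 * (a * b) ≤ a ^ 2 + b ^ 2 := by
  wlog h : a ≤ b generalizing a b
  · rw [mul_comm a, add_comm]
    exact this b a (le_of_not_ge h)
  obtain ⟨d, rfl⟩ := exists_add_of_le h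
  calc 2 * (a * (a + d)) ≤ 2 * (a * (a + d)) + d ^ 2 := le_self_add
    _ = a ^ 2 + (a + d) ^ 2 := by ring

theorem measure_univ_le_capacity {μ : Measure T.Boundary} [IsFiniteMeasure μ]
    (hE : μ Set.univ ≤ μ E) (henergy : ∑' α, T.copotential μ α ^ 2 = μ Set.univ) :
    μ Set.univ ≤ T.capacity E := by
  refine le_iInf₂ fun f hf => ?_
  have hmass : μ Set.univ ≤ ∑' α, f α * T.copotential μ α := by
    calc μ Set.univ ≤ μ {ζ | 1 ≤ T.potential f ζ} := hE.trans (measure_mono hf)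
      _ ≤ ∫⁻ ζ, T.potential f ζ ∂μ := by
          simpa using mul_meas_ge_le_lintegral (μ := μ) (measurable_potential f) 1
      _ = ∑' α, f α * T.copotential μ α := lintegral_potential f μ
  refine (ENNReal.add_le_add_iff_right (measure_ne_top μ Set.univ)).1 ?_
  calc μ Set.univ + μ Set.univ ≤ ∑' α, 2 * (f α * T.copotential μ α) := by
        rw [ENNReal.tsum_mul_left, two_mul]
        gcongr
    _ ≤ ∑' α, (f α ^ 2 + T.copotential μ α ^ 2) := by
        gcongr
        exact two_mul_mul_le_sq_add_sq _ _
    _ = ∑' α, f α ^ 2 + μ Set.univ := by rw [ENNReal.tsum_add, henergy]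

theorem exists_iUnion_isClosed_measure_ge {X : Type*} [TopologicalSpace X] [MeasurableSpace X]
    {μ : Measure X} [IsFiniteMeasure μ] [μ.WeaklyRegular] {G : Set X} (hG : MeasurableSet G) :
    ∃ K : ℕ → Set X, (∀ n, IsClosed (K n)) ∧ (∀ n, K n ⊆ G) ∧ μ G ≤ μ (⋃ n, K n) := by
  choose K hKG hK hlt using fun n : ℕ =>
    hG.exists_isClosed_lt_add (μ := μ) (measure_ne_top μ G) (ε := (n : ℝ≥0∞)⁻¹) (by simp)
  refine ⟨K, hK, hKG, ?_⟩
  have hlim := ENNReal.tendsto_inv_nat_nhds_zero.const_add (μ (⋃ n, K n))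
  rw [add_zero] at hlim
  exact ge_of_tendsto' hlim fun n =>
    (hlt n).le.trans (by gcongr; exact Set.subset_iUnion K n)

theorem exists_iUnion_isClosed_isEquilibriumMeasure {μ : Measure T.Boundary} [IsFiniteMeasure μ]
    (henergy : ∑' α, T.copotential μ α ^ 2 = μ Set.univ)
    (hle : ∀ ζ, T.potential (T.copotential μ) ζ ≤ 1) :
    ∃ K : ℕ → Set T.Boundary, (∀ n, IsClosed (K n)) ∧ T.IsEquilibriumMeasure (⋃ n, K n) μ := by
  have hint : ∫⁻ ζ, T.potential (T.copotential μ) ζ ∂μ = μ Set.univ := by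
    simp_rw [lintegral_potential, ← henergy, sq]
  have hae : T.potential (T.copotential μ) =ᵐ[μ] fun _ => 1 :=
    ae_eq_of_ae_le_of_lintegral_le (.of_forall hle) (hint ▸ measure_ne_top μ Set.univ)
      aemeasurable_const (by simp [hint])
  obtain ⟨K, hK, hKG, hμK⟩ := exists_iUnion_isClosed_measure_ge (μ := μ)
    (measurableSet_le measurable_const (measurable_potential (T.copotential μ)) :
      MeasurableSet {ζ | 1 ≤ T.potential (T.copotential μ) ζ})
  rw [measure_congr (Filter.eventuallyEq_univ.2 (hae.mono fun ζ hζ => hζ.ge))] at hμK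
  have hE : ∀ ζ ∈ ⋃ n, K n, 1 ≤ T.potential (T.copotential μ) ζ := Set.iUnion_subset hKG
  have hcap : μ Set.univ = T.capacity (⋃ n, K n) :=
    (measure_univ_le_capacity hμK henergy).antisymm (henergy ▸ capacity_le_of_potential hE)
  have hempty : {ζ ∈ ⋃ n, K n | T.potential (T.copotential μ) ζ < 1} = ∅ :=
    Set.eq_empty_of_forall_notMem fun ζ hζ => (hE ζ hζ.1).not_gt hζ.2
  exact ⟨K, hK, hempty ▸ capacity_empty, henergy.trans hcap, hcap⟩

end Equilibrium

end PlantedTree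

namespace PlaneSquare

/-- The projection of a square to the horizontal axis. -/
def shadow (Q : PlaneSquare) : Set ℝ := Set.Icc Q.x (Q.x + Q.side)

variable {Q R : PlaneSquare}

theorem interior_shadow (Q : PlaneSquare) :
    interior Q.shadow = Set.Ioo Q.x (Q.x + Q.side) := interior_Icc

theorem volume_shadow (Q : PlaneSquare) : volume Q.shadow = ENNReal.ofReal Q.side := by
  rw [shadow, Real.volume_Icc, add_sub_cancel_left]

theorem volume_interior_shadow (Q : PlaneSquare) :
    volume (interior Q.shadow) = ENNReal.ofReal Q.side := by
  rw [interior_shadow, Real.volume_Ioo, add_sub_cancel_left]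

theorem interior_carrier (Q : PlaneSquare) :
    interior Q.carrier = interior Q.shadow ×ˢ Set.Ioo Q.y (Q.y + Q.side) := by
  rw [carrier, interior_prod_eq, interior_Icc (a := Q.y), shadow]

theorem isClosed_carrier (Q : PlaneSquare) : IsClosed Q.carrier := isClosed_Icc.prod isClosed_Icc

theorem carrier_subset_prod_iff {a b c d : ℝ} :
    Q.carrier ⊆ Set.Icc a b ×ˢ Set.Icc c d ↔
      Q.shadow ⊆ Set.Icc a b ∧ c ≤ Q.y ∧ Q.y + Q.side ≤ d := by
  have hx : Q.x ≤ Q.x + Q.side := le_add_of_nonneg_right Q.side_nonneg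
  have hy : Q.y ≤ Q.y + Q.side := le_add_of_nonneg_right Q.side_nonneg
  rw [carrier, Set.prod_subset_prod_iff, ← Set.Icc_subset_Icc_iff hy, shadow]
  simp only [Set.Icc_eq_empty_iff, hx, hy, not_true_eq_false, or_false]

theorem upperSide_subset_lowerSide_iff :
    Q.upperSide ⊆ R.lowerSide ↔ Q.shadow ⊆ R.shadow ∧ Q.y + Q.side = R.y := by
  have hx : Q.x ≤ Q.x + Q.side := le_add_of_nonneg_right Q.side_nonneg
  rw [upperSide, lowerSide, Set.prod_subset_prod_iff, Set.singleton_subset_singleton, shadow,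
    shadow]
  simp only [Set.Icc_eq_empty_iff, hx, not_true_eq_false, Set.singleton_ne_empty, or_false]

theorem disjoint_interior_of_shadow (h : Disjoint (interior Q.shadow) (interior R.shadow)) :
    Disjoint (interior Q.carrier) (interior R.carrier) := by
  rw [interior_carrier, interior_carrier]
  exact Set.disjoint_prod.2 (.inl h)

theorem disjoint_interior_of_top_le (h : Q.y + Q.side ≤ R.y) :
    Disjoint (interior Q.carrier) (interior R.carrier) := by
  rw [interior_carrier, interior_carrier]
  exact Set.disjoint_prod.2
    (.inr (Set.Ioo_disjoint_Ioo.2 ((min_le_left _ _).trans (h.trans (le_max_right _ _)))))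

theorem disjoint_interior_shadow (htop : Q.y + Q.side = R.y + R.side)
    (h : Disjoint (interior Q.carrier) (interior R.carrier)) :
    Disjoint (interior Q.shadow) (interior R.shadow) := by
  rw [interior_carrier, interior_carrier] at h
  obtain h | h := Set.disjoint_prod.1 h
  · exact h
  · rw [Set.Ioo_disjoint_Ioo, htop, min_self, le_max_iff] at h
    rw [interior_shadow, interior_shadow, Set.Ioo_disjoint_Ioo, min_le_iff, le_max_iff, le_max_iff]
    exact h.imp (fun h => .inl (by linarith)) fun h => .inr (by linarith)

theorem volume_carrier (Q : PlaneSquare) : volume Q.carrier = ENNReal.ofReal Q.side ^ 2 := by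
  rw [carrier, Measure.volume_eq_prod, Measure.prod_prod, Real.volume_Icc, Real.volume_Icc,
    add_sub_cancel_left, add_sub_cancel_left, sq]

theorem interior_ae_eq_carrier (Q : PlaneSquare) :
    (interior Q.carrier : Set (ℝ × ℝ)) =ᵐ[volume] Q.carrier := by
  refine ae_eq_of_subset_of_measure_ge interior_subset ?_ measurableSet_interior.nullMeasurableSet
    (by rw [volume_carrier]; finiteness)
  rw [volume_carrier, interior_carrier, Measure.volume_eq_prod, Measure.prod_prod,
    volume_interior_shadow, Real.volume_Ioo, add_sub_cancel_left, sq]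

theorem volume_iUnion_carrier {ι : Type*} [Countable ι] {Q : ι → PlaneSquare}
    (h : ∀ i j, i ≠ j → Disjoint (interior (Q i).carrier) (interior (Q j).carrier)) :
    volume (⋃ i, (Q i).carrier) = ∑' i, ENNReal.ofReal (Q i).side ^ 2 := by
  rw [measure_iUnion₀ (fun i j hij => ?_)
    fun i => (Q i).isClosed_carrier.measurableSet.nullMeasurableSet]
  · simp_rw [volume_carrier]
  · rw [Function.onFun, AEDisjoint, ← measure_congr
      ((Q i).interior_ae_eq_carrier.inter (Q j).interior_ae_eq_carrier),
      (h i j hij).inter_eq, measure_empty]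

end PlaneSquare

namespace IsSquareTiling

variable {ι : Type*} {Q : ι → PlaneSquare} {R : Set (ℝ × ℝ)}

theorem iUnion_carrier_subset (h : IsSquareTiling Q R) : ⋃ i, (Q i).carrier ⊆ R :=
  subset_closure.trans h.closure_eq.subset

theorem carrier_subset (h : IsSquareTiling Q R) (i : ι) : (Q i).carrier ⊆ R :=
  (Set.subset_iUnion _ i).trans h.iUnion_carrier_subset

variable [Countable ι]

theorem volume_diff_interior (h : IsSquareTiling Q R) :
    volume (R \ ⋃ i, interior (Q i).carrier) = 0 := by
  have hae : (⋃ i, interior (Q i).carrier : Set (ℝ × ℝ)) =ᵐ[volume] ⋃ i, (Q i).carrier :=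
    .countable_iUnion fun i => (Q i).interior_ae_eq_carrier
  exact (measure_congr (ae_eq_set_sdiff (ae_eq_refl R) hae)).trans h.volume_diff

theorem tsum_side_sq (h : IsSquareTiling Q R) :
    ∑' i, ENNReal.ofReal (Q i).side ^ 2 = volume R := by
  rw [← PlaneSquare.volume_iUnion_carrier h.disjoint_interior]
  exact measure_eq_measure_of_null_sdiff h.iUnion_carrier_subset h.volume_diff

theorem of_tsum_side_sq (hR : closure (interior R) = R) (hfin : volume R ≠ ∞)
    (hsub : ∀ i, (Q i).carrier ⊆ R)
    (hdisj : ∀ i j, i ≠ j → Disjoint (interior (Q i).carrier) (interior (Q j).carrier))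
    (hsum : ∑' i, ENNReal.ofReal (Q i).side ^ 2 = volume R) : IsSquareTiling Q R := by
  have hU : ⋃ i, (Q i).carrier ⊆ R := Set.iUnion_subset hsub
  have hclosed : IsClosed R := hR ▸ isClosed_closure
  have hvol : volume (⋃ i, (Q i).carrier) = volume R := by
    rw [PlaneSquare.volume_iUnion_carrier hdisj, hsum]
  have hdiff : volume (R \ ⋃ i, (Q i).carrier) = 0 := by
    have hm : MeasurableSet (⋃ i, (Q i).carrier) :=
      MeasurableSet.iUnion fun i => (Q i).isClosed_carrier.measurableSet
    rw [measure_sdiff hU hm.nullMeasurableSet (hvol ▸ hfin), hvol, tsub_self]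
  have hempty : interior R \ closure (⋃ i, (Q i).carrier) = ∅ :=
    (isOpen_interior.sdiff isClosed_closure).eq_empty_of_measure_zero
      (measure_mono_null (Set.sdiff_subset_sdiff interior_subset subset_closure) hdiff)
  refine ⟨hdisj, (closure_minimal hU hclosed).antisymm ?_, hdiff⟩
  rw [← hR]
  exact closure_minimal (Set.sdiff_eq_empty.1 hempty) isClosed_closure

end IsSquareTiling

theorem volume_rectangle (c : ℝ) :
    volume (Set.Icc 0 c ×ˢ Set.Icc 0 1 : Set (ℝ × ℝ)) = ENNReal.ofReal c := by
  rw [Measure.volume_eq_prod, Measure.prod_prod, Real.volume_Icc, Real.volume_Icc, sub_zero,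
    sub_zero, ENNReal.ofReal_one, mul_one]

theorem closure_interior_rectangle {c : ℝ} (hc : 0 < c) :
    closure (interior (Set.Icc 0 c ×ˢ Set.Icc 0 1 : Set (ℝ × ℝ))) =
      Set.Icc 0 c ×ˢ Set.Icc 0 1 := by
  rw [interior_prod_eq, closure_prod_eq, closure_interior_Icc hc.ne,
    closure_interior_Icc zero_ne_one]

namespace PlantedTree

variable {V : Type*} {T : PlantedTree V}

open Edge

namespace PrescribesCombinatorics

variable {Q : T.Edge → PlaneSquare} {α β : T.Edge} {c : ℝ} {R : Set (ℝ × ℝ)}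

theorem shadow_subset (hC : T.PrescribesCombinatorics Q) (h : β.b = α.e) :
    (Q β).shadow ⊆ (Q α).shadow :=
  (PlaneSquare.upperSide_subset_lowerSide_iff.1 (hC β α h)).1

theorem top_eq (hC : T.PrescribesCombinatorics Q) (h : β.b = α.e) :
    (Q β).y + (Q β).side = (Q α).y :=
  (PlaneSquare.upperSide_subset_lowerSide_iff.1 (hC β α h)).2

theorem shadow_antitone (hC : T.PrescribesCombinatorics Q) : Antitone fun α => (Q α).shadow :=
  antitone_of_child fun _ _ h => hC.shadow_subset h

theorem top_antitone (hC : T.PrescribesCombinatorics Q) :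
    Antitone fun α => (Q α).y + (Q α).side :=
  antitone_of_child fun α _ h => (hC.top_eq h).trans_le (le_add_of_nonneg_right (Q α).side_nonneg)

theorem top_le_of_lt (hC : T.PrescribesCombinatorics Q) (h : α < β) :
    (Q β).y + (Q β).side ≤ (Q α).y := by
  obtain ⟨γ, hγ, hle⟩ := (eq_or_exists_child_le h.le).resolve_left h.ne
  exact (hC.top_antitone hle).trans_eq (hC.top_eq hγ)

theorem top_eq_top_of_siblings (hC : T.PrescribesCombinatorics Q) (h : α.b = β.b) :
    (Q α).y + (Q α).side = (Q β).y + (Q β).side := by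
  obtain rfl | ⟨γ, hγ⟩ := α.eq_bot_or_exists_parent
  · rw [b_eq_root_iff.1 (h.symm.trans (b_eq_root_iff.2 rfl))]
  · rw [hC.top_eq hγ, hC.top_eq (h.symm.trans hγ)]

theorem disjoint_interior (hC : T.PrescribesCombinatorics Q)
    (hsib : ∀ α β : T.Edge, α.b = β.b → α ≠ β →
      Disjoint (interior (Q α).shadow) (interior (Q β).shadow)) (hne : α ≠ β) :
    Disjoint (interior (Q α).carrier) (interior (Q β).carrier) := by
  obtain h | h | ⟨α', β', hb, hne', hα, hβ⟩ := comparable_or_exists_siblings α β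
  · exact (PlaneSquare.disjoint_interior_of_top_le (hC.top_le_of_lt (h.lt_of_ne hne))).symm
  · exact PlaneSquare.disjoint_interior_of_top_le (hC.top_le_of_lt (h.lt_of_ne hne.symm))
  · exact PlaneSquare.disjoint_interior_of_shadow ((hsib α' β' hb hne').mono
      (interior_mono (hC.shadow_antitone hα)) (interior_mono (hC.shadow_antitone hβ)))

theorem disjoint_interior_shadow_of_siblings (hC : T.PrescribesCombinatorics Q)
    (hQ : IsSquareTiling Q R) (h : α.b = β.b) (hne : α ≠ β) :
    Disjoint (interior (Q α).shadow) (interior (Q β).shadow) :=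
  PlaneSquare.disjoint_interior_shadow (hC.top_eq_top_of_siblings h)
    (hQ.disjoint_interior α β hne)

theorem subset_shadow_bot_prod (hC : T.PrescribesCombinatorics Q) (hQ : IsSquareTiling Q R) :
    R ⊆ (Q ⊥).shadow ×ˢ Set.Iic ((Q ⊥).y + (Q ⊥).side) := by
  rw [← hQ.closure_eq]
  refine closure_minimal (Set.iUnion_subset fun α => ?_) (isClosed_Icc.prod isClosed_Iic)
  exact Set.prod_mono (hC.shadow_antitone bot_le) fun y hy => hy.2.trans (hC.top_antitone bot_le)

theorem shadow_bot (hC : T.PrescribesCombinatorics Q)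
    (hQ : IsSquareTiling Q (Set.Icc 0 c ×ˢ Set.Icc 0 1)) : (Q ⊥).shadow = Set.Icc 0 c :=
  (PlaneSquare.carrier_subset_prod_iff.1 (hQ.carrier_subset ⊥)).1.antisymm fun x hx =>
    (hC.subset_shadow_bot_prod hQ (a := (x, 1)) ⟨hx, Set.right_mem_Icc.2 zero_le_one⟩).1

theorem side_bot (hC : T.PrescribesCombinatorics Q) (hc : 0 < c)
    (hQ : IsSquareTiling Q (Set.Icc 0 c ×ˢ Set.Icc 0 1)) : (Q ⊥).side = c := by
  have h := (Q ⊥).volume_shadow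
  rw [hC.shadow_bot hQ, Real.volume_Icc, sub_zero] at h
  exact ((ENNReal.ofReal_eq_ofReal_iff hc.le (Q ⊥).side_nonneg).1 h).symm

theorem top_bot (hC : T.PrescribesCombinatorics Q) (hc : 0 < c)
    (hQ : IsSquareTiling Q (Set.Icc 0 c ×ˢ Set.Icc 0 1)) : (Q ⊥).y + (Q ⊥).side = 1 :=
  (PlaneSquare.carrier_subset_prod_iff.1 (hQ.carrier_subset ⊥)).2.2.antisymm
    (hC.subset_shadow_bot_prod hQ (a := (0, 1))
      ⟨Set.left_mem_Icc.2 hc.le, Set.right_mem_Icc.2 zero_le_one⟩).2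

theorem pathSum_side (hC : T.PrescribesCombinatorics Q) (α : T.Edge) :
    pathSum (fun β => (Q β).side) α = (Q ⊥).y + (Q ⊥).side - (Q α).y := by
  induction α using induction_children with
  | bot => rw [pathSum_bot, add_sub_cancel_left]
  | child α β hβ ih =>
    rw [pathSum_child _ hβ, ih, ← hC.top_eq hβ]
    ring

theorem potential_side_le_one (hC : T.PrescribesCombinatorics Q) (hc : 0 < c)
    (hQ : IsSquareTiling Q (Set.Icc 0 c ×ˢ Set.Icc 0 1)) (ζ : T.Boundary) :
    T.potential (fun α => ENNReal.ofReal (Q α).side) ζ ≤ 1 := by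
  rw [potential_eq_iSup]
  refine iSup_le fun α => ?_
  rw [pathSum_ofReal fun α => (Q α).side_nonneg, ENNReal.ofReal_le_one, hC.pathSum_side,
    hC.top_bot hc hQ]
  exact sub_le_self _ (PlaneSquare.carrier_subset_prod_iff.1 (hQ.carrier_subset α)).2.1

theorem sum_children_side_le (hC : T.PrescribesCombinatorics Q) (hQ : IsSquareTiling Q R)
    (α : T.Edge) : ∑ β ∈ T.edgesFrom α.e, (Q β).side ≤ (Q α).side := by
  rw [← ENNReal.ofReal_le_ofReal_iff (Q α).side_nonneg,
    ENNReal.ofReal_sum_of_nonneg fun β _ => (Q β).side_nonneg, ← (Q α).volume_shadow]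
  simp_rw [← PlaneSquare.volume_interior_shadow]
  rw [← measure_biUnion_finset (fun β hβ γ hγ hne => ?_) fun _ _ => measurableSet_interior]
  · exact measure_mono (Set.iUnion₂_subset fun β hβ =>
      interior_subset.trans (hC.shadow_subset (mem_edgesFrom.1 hβ)))
  · exact hC.disjoint_interior_shadow_of_siblings hQ
      ((mem_edgesFrom.1 hβ).trans (mem_edgesFrom.1 hγ).symm) hne

theorem disjoint_gap_prod_Iio (hC : T.PrescribesCombinatorics Q) (hQ : IsSquareTiling Q R)
    (α γ : T.Edge) :
    Disjoint ((interior (Q α).shadow \ ⋃ β ∈ T.edgesFrom α.e, (Q β).shadow) ×ˢ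
      Set.Iio (Q α).y) (interior (Q γ).carrier) := by
  rw [PlaneSquare.interior_carrier, Set.disjoint_prod]
  obtain h | h | ⟨α', γ', hb, hne, hα, hγ⟩ := comparable_or_exists_siblings α γ
  · obtain rfl | ⟨β, hβ, hle⟩ := eq_or_exists_child_le h
    · exact .inr (Set.disjoint_left.2 fun y hy hy' => lt_asymm hy hy'.1)
    · exact .inl (Set.disjoint_left.2 fun x hx hx' => hx.2 (Set.mem_biUnion (mem_edgesFrom.2 hβ)
        (hC.shadow_antitone hle (interior_subset hx'))))
  · refine .inr (Set.disjoint_left.2 fun y hy hy' => lt_asymm hy (lt_of_le_of_lt ?_ hy'.1))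
    obtain rfl | h := h.eq_or_lt
    · exact le_rfl
    · exact (le_add_of_nonneg_right (Q α).side_nonneg).trans (hC.top_le_of_lt h)
  · exact .inl ((hC.disjoint_interior_shadow_of_siblings hQ hb hne).mono
      (Set.sdiff_subset.trans (interior_mono (hC.shadow_antitone hα)))
      (interior_mono (hC.shadow_antitone hγ)))

theorem volume_gap_eq_zero (hC : T.PrescribesCombinatorics Q)
    (hQ : IsSquareTiling Q (Set.Icc 0 c ×ˢ Set.Icc 0 1)) (hy : 0 < (Q α).y) :
    volume (interior (Q α).shadow \ ⋃ β ∈ T.edgesFrom α.e, (Q β).shadow) = 0 := by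
  set G := interior (Q α).shadow \ ⋃ β ∈ T.edgesFrom α.e, (Q β).shadow
  obtain ⟨hshadow, -, htop⟩ := PlaneSquare.carrier_subset_prod_iff.1 (hQ.carrier_subset α)
  have hsub : G ×ˢ Set.Ioo 0 (Q α).y ⊆
      (Set.Icc 0 c ×ˢ Set.Icc 0 1) \ ⋃ γ, interior (Q γ).carrier := by
    refine Set.subset_sdiff.2 ⟨Set.prod_mono ?_ ?_, Set.disjoint_iUnion_right.2 fun γ => ?_⟩
    · exact Set.sdiff_subset.trans (interior_subset.trans hshadow)
    · exact fun y hy => ⟨hy.1.le, by linarith [hy.2, (Q α).side_nonneg]⟩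
    · exact (hC.disjoint_gap_prod_Iio hQ α γ).mono_left
        (Set.prod_mono_right Set.Ioo_subset_Iio_self)
  have hstrip := measure_mono_null hsub hQ.volume_diff_interior
  rw [Measure.volume_eq_prod, Measure.prod_prod, Real.volume_Ioo, sub_zero] at hstrip
  exact (mul_eq_zero.1 hstrip).resolve_right (ENNReal.ofReal_pos.2 hy).ne'

theorem side_le_sum_children (hC : T.PrescribesCombinatorics Q)
    (hQ : IsSquareTiling Q (Set.Icc 0 c ×ˢ Set.Icc 0 1)) (hy : 0 < (Q α).y) :
    (Q α).side ≤ ∑ β ∈ T.edgesFrom α.e, (Q β).side := by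
  rw [← ENNReal.ofReal_le_ofReal_iff (Finset.sum_nonneg fun β _ => (Q β).side_nonneg),
    ENNReal.ofReal_sum_of_nonneg fun β _ => (Q β).side_nonneg, ← (Q α).volume_interior_shadow]
  simp_rw [← PlaneSquare.volume_shadow]
  calc volume (interior (Q α).shadow)
      ≤ volume (⋃ β ∈ T.edgesFrom α.e, (Q β).shadow) :=
        measure_mono_ae (ae_le_set.2 (hC.volume_gap_eq_zero hQ hy))
    _ ≤ ∑ β ∈ T.edgesFrom α.e, volume (Q β).shadow := measure_biUnion_finset_le _ _

theorem isFlow_side (hC : T.PrescribesCombinatorics Q)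
    (hQ : IsSquareTiling Q (Set.Icc 0 c ×ˢ Set.Icc 0 1)) (hD : T.DegeneratesOnlyProperly Q) :
    IsFlow fun α => (Q α).side := by
  refine ⟨fun α => (Q α).side_nonneg, fun α hl => (hC.sum_children_side_le hQ α).antisymm ?_⟩
  obtain hs | hs := (Q α).side_nonneg.eq_or_lt
  · exact hs.symm.trans_le (Finset.sum_nonneg fun β _ => (Q β).side_nonneg)
  · obtain ⟨β, hβ, hβs⟩ := hD α hl hs
    have hyβ := (PlaneSquare.carrier_subset_prod_iff.1 (hQ.carrier_subset β)).2.1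
    exact hC.side_le_sum_children hQ (by linarith [hC.top_eq hβ])

end PrescribesCombinatorics

namespace IsFlow

variable {m : T.Edge → ℝ}

/-- The squares with sides `m`, hung below each other from height `1`. The square of `α` lies
below the interval which `m` assigns to `α`. -/
noncomputable def square (hm : IsFlow m) (α : T.Edge) : PlaneSquare :=
  ⟨left m α, 1 - pathSum m α, m α, hm.nonneg α⟩

theorem prescribesCombinatorics_square (hm : IsFlow m) :
    T.PrescribesCombinatorics hm.square := by
  refine fun β α h => PlaneSquare.upperSide_subset_lowerSide_iff.2
    ⟨Set.Icc_subset_Icc (hm.left_le_left h) (hm.right_le_right h), ?_⟩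
  simp only [square, pathSum_child m h]
  ring

theorem disjoint_interior_square (hm : IsFlow m) {α β : T.Edge} (hne : α ≠ β) :
    Disjoint (interior (hm.square α).carrier) (interior (hm.square β).carrier) := by
  refine hm.prescribesCombinatorics_square.disjoint_interior (fun α β h hne => ?_) hne
  rw [PlaneSquare.interior_shadow, PlaneSquare.interior_shadow, Set.Ioo_disjoint_Ioo, min_le_iff,
    le_max_iff, le_max_iff]
  exact (hm.left_add_le_left_or h hne).imp .inr .inl

theorem carrier_square_subset (hm : IsFlow m) (hle : ∀ α, pathSum m α ≤ 1) (α : T.Edge) :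
    (hm.square α).carrier ⊆ Set.Icc 0 (m ⊥) ×ˢ Set.Icc 0 1 := by
  have hC := hm.prescribesCombinatorics_square
  refine PlaneSquare.carrier_subset_prod_iff.2 ⟨?_, sub_nonneg.2 (hle α), ?_⟩
  · refine (hC.shadow_antitone bot_le).trans_eq ?_
    simp only [PlaneSquare.shadow, square, left_bot, zero_add]
  · refine (hC.top_antitone bot_le).trans_eq ?_
    simp only [square, pathSum_bot, sub_add_cancel]

theorem isSquareTiling_square (hm : IsFlow m) (hpos : 0 < m ⊥) (hle : ∀ α, pathSum m α ≤ 1)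
    (henergy : ∑' α, ENNReal.ofReal (m α) ^ 2 = ENNReal.ofReal (m ⊥)) :
    IsSquareTiling hm.square (Set.Icc 0 (m ⊥) ×ˢ Set.Icc 0 1) :=
  .of_tsum_side_sq (closure_interior_rectangle hpos)
    (by rw [volume_rectangle]; exact ENNReal.ofReal_ne_top) (hm.carrier_square_subset hle)
    (fun _ _ hne => hm.disjoint_interior_square hne) (henergy.trans (volume_rectangle _).symm)

end IsFlow

end PlantedTree

open PlantedTree in
theorem mainTheorem3 {V : Type*} (T : PlantedTree V) :
    (∀ E : Set T.Boundary,
      (∃! μ : Measure T.Boundary, T.IsEquilibriumMeasure E μ) ∧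
      (0 < T.capacity E → ∀ μ : Measure T.Boundary, T.IsEquilibriumMeasure E μ →
        ∃ Q : T.Edge → PlaneSquare,
          IsSquareTiling Q (Set.Icc 0 (T.capacity E).toReal ×ˢ Set.Icc 0 1) ∧
          T.PrescribesCombinatorics Q ∧
          ∀ α, ENNReal.ofReal (Q α).side = μ (T.tentBoundary α))) ∧
    (∀ (c : ℝ) (Q : T.Edge → PlaneSquare), 0 < c →
      IsSquareTiling Q (Set.Icc 0 c ×ˢ Set.Icc 0 1) →
      T.PrescribesCombinatorics Q →
      T.DegeneratesOnlyProperly Q →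
      ∃ E : Set T.Boundary,
        (∃ K : ℕ → Set T.Boundary, (∀ n, IsClosed (K n)) ∧ E = ⋃ n, K n) ∧
        ∃ μ : Measure T.Boundary, T.IsEquilibriumMeasure E μ ∧
          ∀ α, μ (T.tentBoundary α) = ENNReal.ofReal (Q α).side) := by
  refine ⟨fun E => ⟨existsUnique_isEquilibriumMeasure E, fun hE μ hμ => ?_⟩,
    fun c Q hc hQ hC hD => ?_⟩
  · obtain ⟨f, hf, hfμ⟩ := hμ.exists_isEquilibriumFunction
    have hcap : T.capacity E = ENNReal.ofReal (f ⊥) := by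
      rw [← hf.norm_sq, hf.norm_sq_eq_apply_bot]
    have henergy : ∑' α, ENNReal.ofReal (f α) ^ 2 = ENNReal.ofReal (f ⊥) := by
      rw [EdgeL2.tsum_ofReal_sq hf.nonneg, hf.norm_sq_eq_apply_bot]
    rw [hcap, ENNReal.toReal_ofReal (hf.nonneg ⊥)]
    exact ⟨hf.isFlow.square, hf.isFlow.isSquareTiling_square
      (ENNReal.ofReal_pos.1 (hcap ▸ hE)) hf.pathSum_le_one henergy,
      hf.isFlow.prescribesCombinatorics_square, fun α => (congrFun hfμ α).symm⟩
  · obtain ⟨μ, hμ⟩ := (hC.isFlow_side hQ hD).exists_copotential_eq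
    have huniv : μ Set.univ = ENNReal.ofReal c := by
      simp only [← copotential_bot, hμ, hC.side_bot hc hQ]
    have henergy : ∑' α, T.copotential μ α ^ 2 = μ Set.univ := by
      rw [hμ, hQ.tsum_side_sq, volume_rectangle, huniv]
    have hpot (ζ : T.Boundary) : T.potential (T.copotential μ) ζ ≤ 1 := by
      rw [hμ]
      exact hC.potential_side_le_one hc hQ ζ
    have : IsFiniteMeasure μ := ⟨huniv ▸ ENNReal.ofReal_lt_top⟩
    obtain ⟨K, hK, hKμ⟩ := exists_iUnion_isClosed_isEquilibriumMeasure henergy hpot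
    exact ⟨_, ⟨K, hK, rfl⟩, μ, hKμ, congrFun hμ⟩
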